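/- Let $\mathsf k$ be a field of characteristic zero, $R=\mathsf k[x,y]$ with the standard grading, and let $d\ge 2$, $k\ge 1$ be integers. Put $j=2d+k-3$ and $$T=(1,2,\dots,d-1,\underbrace{d,\dots,d}_{k},d-1,\dots,2,1),$$ a sequence indexed by the degrees $0,\dots,j$. Let $R$ act on $\mathsf k[X,Y]$ by differentiation ($x$ acts as $\partial_X$, $y$ as $\partial_Y$; write $f\circ F$), and put $\operatorname{Ann}F=\{f\in R: f\circ F=0\}$. For a graded Artinian quotient $A=R/I$ and a nonzero linear form $\ell\in R_1$, the Jordan type $P_{\ell,A}$ is the partition of $\dim_{\mathsf k} A$ given by the Jordan block sizes of the nilpotent map "multiplication by $\ell$" on $A$. A partition $P$ has diagonal lengths $T$ if for each $i$ its Ferrers diagram has exactly $T_i$ boxes (row $r$, column $s$, counted from $0$) with $r+s=i$ (where $T_i=0$ for $i>j$). A partition $P$ of diagonal lengths $T$ is CIJT if $P=P_{\ell,A}$ for some graded complete intersection $A=R/I$ of Hilbert function $T$ and some nonzero linear form $\ell$. Let $F\in \mathsf k[X,Y]_j$ be such that $A=R/\operatorname{Ann}F$ is a graded complete intersection of Hilbert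 function $T$ (call such an $F$ admissible). For a basis $(\alpha_u)$ of $A_i$ let $h^i(F)=\det[\alpha_u\alpha_v\circ F]\in \mathsf k[X,Y]$, which is well defined up to a nonzero constant factor; for $\ell=ax+by$ let $h^i_\ell(F)$ be its value at $(X,Y)=(a,b)$. The active Hessians are $h^0,\dots,h^{d-2}$, together with $h^{d-1}$ if $k\ge 2$; so there are $N=d$ of them if $k\ge 2$ and $N=d-1$ if $k=1$. **Theorem.** (a) There is a bijection $\Phi$ from the set of CIJT partitions of diagonal lengths $T$ to the set of all subsets of the set of active Hessians such that $\Phi(P)=S$ if and only if there are an admissible $F$ and a nonzero linear form $\ell$ with $P=P_{\ell,R/\operatorname{Ann}F}$ for which $S$ is the set of active Hessians vanishing at $\ell$. Hence there are $2^d$ CIJT partitions of diagonal lengths $T$ if $k>1$, and $2^{d-1}$ if $k=1$. (b) Let $n=n_1+\dots+n_c$ be an ordered partition (with positive parts; empty if $n=0$) of an integer $n$ with $0\le n\le N$, and let $$Q=\big(p_1^{n_1},\dots,p_c^{n_c},(d-n)^{d-n+k-1}\big),\qquad p_i=k-1+2d-n_i-2(n_1+\dots+n_{i-1}),$$ where zero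 parts (which occur only if $n=d$) are omitted. For a partition $P$ the following are equivalent: (i) $P=P_{\ell,R/\operatorname{Ann}F}$ for some admissible $F$ and nonzero linear form $\ell$ such that $h_\ell^{n_1+\dots+n_i-1}(F)\ne 0$ for each $i\in[1,c]$ and all other active Hessians vanish at $\ell$; (ii) $P=Q$. Moreover, for every admissible $F$ and every nonzero linear form $\ell$, one has $P_{\ell,R/\operatorname{Ann}F}=Q$ if and only if $h_\ell^{n_1+\dots+n_i-1}(F)\ne 0$ for each $i\in[1,c]$ and all other active Hessians vanish at $\ell$. -/

import Mathlib

namespace CIJordan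

open MvPolynomial

noncomputable section

/-! ### Macaulay duality in two variables: polynomials acting by differentiation -/

section Action

variable {K : Type*} [Field K]

/-- The two partial derivatives commute. -/
theorem pderiv_commute :
    Commute ((pderiv (R := K) (0 : Fin 2)).toLinearMap : Module.End K (MvPolynomial (Fin 2) K))
      (pderiv (R := K) (1 : Fin 2)).toLinearMap := by
  have h : ⁅pderiv (R := K) (0 : Fin 2), pderiv (R := K) (1 : Fin 2)⁆ = 0 := by
    apply MvPolynomial.derivation_ext
    intro i
    rw [Derivation.commutator_apply]
    fin_cases i <;> simp [pderiv_X]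
  have h2 := fun x => congrArg (fun D => D x) h
  apply LinearMap.ext
  intro x
  have := h2 x
  simp only [Derivation.commutator_apply, Derivation.coe_zero, Pi.zero_apply] at this
  exact sub_eq_zero.mp this

/-- `f` as a constant-coefficient differential operator: the monomial `x^i y^j` acts as
`∂_X^i ∂_Y^j`, and this is extended linearly in `f`. -/
def diffOp : MvPolynomial (Fin 2) K →ₗ[K] Module.End K (MvPolynomial (Fin 2) K) :=
  (MvPolynomial.basisMonomials (Fin 2) K).constr K fun m =>
    ((pderiv 0).toLinearMap : Module.End K (MvPolynomial (Fin 2) K)) ^ m 0 *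
      ((pderiv 1).toLinearMap : Module.End K (MvPolynomial (Fin 2) K)) ^ m 1

theorem diffOp_monomial_one (m : Fin 2 →₀ ℕ) :
    diffOp (monomial m (1 : K)) =
      ((pderiv 0).toLinearMap : Module.End K (MvPolynomial (Fin 2) K)) ^ m 0 *
        ((pderiv 1).toLinearMap : Module.End K (MvPolynomial (Fin 2) K)) ^ m 1 := by
  have := (MvPolynomial.basisMonomials (Fin 2) K).constr_basis K (fun m =>
    ((pderiv 0).toLinearMap : Module.End K (MvPolynomial (Fin 2) K)) ^ m 0 *
      ((pderiv 1).toLinearMap : Module.End K (MvPolynomial (Fin 2) K)) ^ m 1) m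
  simpa [diffOp, coe_basisMonomials] using this

theorem diffOp_mul (f g : MvPolynomial (Fin 2) K) : diffOp (f * g) = diffOp f * diffOp g := by
  have key : (LinearMap.mul K (MvPolynomial (Fin 2) K)).compr₂ diffOp =
      (LinearMap.mul K (Module.End K (MvPolynomial (Fin 2) K))).compl₁₂ diffOp diffOp := by
    apply (MvPolynomial.basisMonomials (Fin 2) K).ext
    intro m
    apply (MvPolynomial.basisMonomials (Fin 2) K).ext
    intro n
    have hc := ((pderiv_commute (K := K)).pow_pow (n 0) (m 1)).eq
    simp only [coe_basisMonomials, LinearMap.compr₂_apply, LinearMap.mul_apply',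
      LinearMap.compl₁₂_apply, monomial_mul, mul_one, diffOp_monomial_one, Finsupp.add_apply,
      pow_add]
    simp only [mul_assoc]
    rw [← mul_assoc (_ ^ n 0) (_ ^ m 1), hc]
    simp only [mul_assoc]
  exact congrArg (fun L => L f g) key

/-- The annihilator ideal `Ann F = {f | f ∘ F = 0}` of a polynomial `F`. -/
def annIdeal (F : MvPolynomial (Fin 2) K) : Ideal (MvPolynomial (Fin 2) K) where
  carrier := {f | diffOp f F = 0}
  add_mem' {a b} ha hb := by
    simp only [Set.mem_ofPred_eq] at *
    simp [ha, hb]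
  zero_mem' := by simp
  smul_mem' c f hf := by
    simp only [Set.mem_ofPred_eq] at *
    rw [smul_eq_mul, diffOp_mul, Module.End.mul_apply, hf, map_zero]

/-- The action on `F` of a class in `A = R / Ann F`; it sends the class of `f` to `f ∘ F`. -/
def act (F : MvPolynomial (Fin 2) K) :
    (MvPolynomial (Fin 2) K ⧸ annIdeal F) →ₗ[K] MvPolynomial (Fin 2) K :=
  (((annIdeal F).restrictScalars K).liftQ (diffOp.flip F) (fun _ hf => hf)) ∘ₗ
    (Submodule.Quotient.restrictScalarsEquiv K (annIdeal F)).symm.toLinearMap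

theorem act_mk (F f : MvPolynomial (Fin 2) K) :
    act F (Ideal.Quotient.mk (annIdeal F) f) = diffOp f F := rfl

end Action

/-! ### Graded quotients of `K[x,y]` -/

section Quotients

variable {K : Type*} [Field K]

/-- The degree-`i` graded piece `A_i` of `A = K[x,y] / I` (for a homogeneous ideal `I`): the
image of the forms of degree `i`. -/
def gradedPiece (I : Ideal (MvPolynomial (Fin 2) K)) (i : ℕ) :
    Submodule K (MvPolynomial (Fin 2) K ⧸ I) :=
  (homogeneousSubmodule (Fin 2) K i).map (Ideal.Quotient.mkₐ K I).toLinearMap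

instance finite_homogeneousSubmodule (i : ℕ) :
    Module.Finite K (homogeneousSubmodule (Fin 2) K i) := by
  have : Module.Finite K (restrictTotalDegree (Fin 2) K i) := by
    have hf : {n : Fin 2 →₀ ℕ | n.degree ≤ i}.Finite := Finsupp.finite_of_degree_le i
    have : Finite {n : Fin 2 →₀ ℕ | n.degree ≤ i} := hf
    exact Module.Finite.of_basis (basisRestrictSupport K {n : Fin 2 →₀ ℕ | n.degree ≤ i})
  refine Submodule.finiteDimensional_of_le (S₂ := restrictTotalDegree (Fin 2) K i) ?_
  intro f hf
  rw [mem_restrictTotalDegree]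
  exact IsHomogeneous.totalDegree_le hf

instance finite_gradedPiece (I : Ideal (MvPolynomial (Fin 2) K)) (i : ℕ) :
    Module.Finite K (gradedPiece I i) := by
  unfold gradedPiece
  infer_instance

/-- The Hilbert function `H(A)_i = dim A_i` of `A = K[x,y] / I`. -/
def hilbertFunction (I : Ideal (MvPolynomial (Fin 2) K)) (i : ℕ) : ℕ :=
  Module.finrank K (gradedPiece I i)

/-- `K[x,y] / I` is a graded (Artinian) complete intersection: `I` is generated by a regular
sequence of two homogeneous polynomials. -/
def IsGradedCI (I : Ideal (MvPolynomial (Fin 2) K)) : Prop :=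
  ∃ (f g : MvPolynomial (Fin 2) K) (a b : ℕ), f.IsHomogeneous a ∧ g.IsHomogeneous b ∧
    RingTheory.Sequence.IsRegular (MvPolynomial (Fin 2) K) [f, g] ∧ I = Ideal.span {f, g}

/-- The linear form `ℓ = p₀ x + p₁ y` attached to the point `p = (p₀, p₁)`. -/
def linearForm (p : Fin 2 → K) : MvPolynomial (Fin 2) K :=
  C (p 0) * X 0 + C (p 1) * X 1

/-- Multiplication by `ℓ = p₀ x + p₁ y` on `A = K[x,y] / I`. -/
def mulLinear (I : Ideal (MvPolynomial (Fin 2) K)) (p : Fin 2 → K) :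
    Module.End K (MvPolynomial (Fin 2) K ⧸ I) :=
  LinearMap.mulLeft K (Ideal.Quotient.mk I (linearForm p))

end Quotients

/-! ### Partitions and Jordan types

A partition is given by its Ferrers diagram, whose rows are the parts. -/

/-- The number of boxes on the `i`-th diagonal (of slope one) of the Ferrers diagram of `P`. -/
def diagonalLength (P : YoungDiagram) (i : ℕ) : ℕ :=
  (P.cells.filter fun c => c.1 + c.2 = i).card

/-- The sequence `T(d,k) = (1, 2, …, d-1, d^k, d-1, …, 2, 1, 0, 0, …)` (indexed from `0`), whose
last nonzero entry, `1`, is in degree `j = 2d+k-3`. -/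
def seqT (d k i : ℕ) : ℕ :=
  min (min (i + 1) d) (2 * d + k - 2 - i)

open Classical in
/-- The partition `P` is the Jordan type of the nilpotent endomorphism `φ`: there is a basis of
the space, indexed by the boxes of the Ferrers diagram of `P`, in which every row is a Jordan
string (`φ` moves each box to the next one in its row, and kills the last box of each row). -/
def IsJordanType {K V : Type*} [Field K] [AddCommGroup V] [Module K V]
    (φ : Module.End K V) (P : YoungDiagram) : Prop :=
  ∃ b : Module.Basis {c : ℕ × ℕ // c ∈ P} K V, ∀ c : {c : ℕ × ℕ // c ∈ P},
    φ (b c) = if h : (c.1.1, c.1.2 + 1) ∈ P then b ⟨(c.1.1, c.1.2 + 1), h⟩ else 0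

/-- `P` is a complete intersection Jordan type partition of diagonal lengths `T(d,k)`. -/
def IsCIJT (K : Type*) [Field K] (d k : ℕ) (P : YoungDiagram) : Prop :=
  (∀ i, diagonalLength P i = seqT d k i) ∧
    ∃ I : Ideal (MvPolynomial (Fin 2) K), IsGradedCI I ∧ (∀ i, hilbertFunction I i = seqT d k i) ∧
      ∃ p : Fin 2 → K, p ≠ 0 ∧ IsJordanType (mulLinear I p) P

/-! ### Hessians -/

section Hessians

variable {K : Type*} [Field K]

/-- The Hessian matrix `[α_u α_v ∘ F]` of `F` with respect to a family `α` of elements of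
`A = R / Ann F`. -/
def hessianMatrix (F : MvPolynomial (Fin 2) K) {ι : Type*}
    (α : ι → MvPolynomial (Fin 2) K ⧸ annIdeal F) : Matrix ι ι (MvPolynomial (Fin 2) K) :=
  Matrix.of fun u v => act F (α u * α v)

/-- The `i`-th Hessian `h^i(F)`: the determinant of the Hessian matrix with respect to a
basis of `A_i`, where `A = R / Ann F`. It depends on the basis only up to a nonzero constant
factor (see `hessian_eq_zero_iff`), so a basis is chosen. -/
def hessian (F : MvPolynomial (Fin 2) K) (i : ℕ) : MvPolynomial (Fin 2) K :=
  (hessianMatrix F fun u =>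
    (Module.finBasis K (gradedPiece (annIdeal F) i) u : MvPolynomial (Fin 2) K ⧸ annIdeal F)).det

/-- The value `h^i_ℓ(F)` of the `i`-th Hessian at the point `p` of `ℓ = p₀ x + p₁ y`. -/
def hessianAt (F : MvPolynomial (Fin 2) K) (i : ℕ) (p : Fin 2 → K) : K :=
  eval p (hessian F i)

/-- Independence of the basis: the value of the Hessian may be tested for vanishing in any
basis of `A_i`. -/
theorem hessian_eq_zero_iff (F : MvPolynomial (Fin 2) K) (i : ℕ) (p : Fin 2 → K)
    {ι : Type*} [Fintype ι] [DecidableEq ι]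
    (b : Module.Basis ι K (gradedPiece (annIdeal F) i)) :
    hessianAt F i p = 0 ↔
      eval p (hessianMatrix F fun u =>
        (b u : MvPolynomial (Fin 2) K ⧸ annIdeal F)).det = 0 := by
  let B : LinearMap.BilinForm K (gradedPiece (annIdeal F) i) :=
    LinearMap.mk₂ K (fun s t => eval p (act F ((s : MvPolynomial (Fin 2) K ⧸ annIdeal F) * t)))
      (by intros; simp [add_mul])
      (by intros; rw [Submodule.coe_smul, smul_mul_assoc, map_smul, smul_eval, smul_eq_mul])
      (by intros; simp [mul_add])
      (by intros; rw [Submodule.coe_smul, mul_smul_comm, map_smul, smul_eval, smul_eq_mul])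
  have h1 : hessianAt F i p =
      (LinearMap.BilinForm.toMatrix (Module.finBasis K (gradedPiece (annIdeal F) i)) B).det := by
    rw [hessianAt, hessian, RingHom.map_det]
    congr 1
    ext u v
    simp [B, hessianMatrix]
  have h2 : eval p (hessianMatrix F fun u =>
      (b u : MvPolynomial (Fin 2) K ⧸ annIdeal F)).det =
      (LinearMap.BilinForm.toMatrix b B).det := by
    rw [RingHom.map_det]
    congr 1
    ext u v
    simp [B, hessianMatrix]
  rw [h1, h2, ← not_iff_not]
  exact (LinearMap.BilinForm.nondegenerate_iff_det_ne_zero _).symm.trans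
    (LinearMap.BilinForm.nondegenerate_iff_det_ne_zero _)

/-- `F` is the Macaulay dual generator of a graded complete intersection `A = R / Ann F` of
Hilbert function `T(d,k)`; it is a form of degree the socle degree `j = 2d+k-3`. -/
structure IsCIDualGenerator (d k : ℕ) (F : MvPolynomial (Fin 2) K) : Prop where
  isHomogeneous : F.IsHomogeneous (2 * d + k - 3)
  isGradedCI : IsGradedCI (annIdeal F)
  hilbertFunction_eq : ∀ i, hilbertFunction (annIdeal F) i = seqT d k i

end Hessians

/-- The number of active Hessians `h^0, h^1, …`: these are `h^0, …, h^{d-2}`, together with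
`h^{d-1}` if `k ≥ 2`. -/
def numActive (d k : ℕ) : ℕ := if 2 ≤ k then d else d - 1

/-- The set of active Hessians of `F` that vanish at `ℓ = p₀ x + p₁ y`. -/
def vanishingSet {K : Type*} [Field K] (d k : ℕ) (F : MvPolynomial (Fin 2) K) (p : Fin 2 → K) :
    Set (Fin (numActive d k)) :=
  {i | hessianAt F i p = 0}

/-- For an ordered partition `n = n₁ + ⋯ + n_c`, the set of active Hessians other than the
`h^{n₁+⋯+n_i-1}`, `1 ≤ i ≤ c`. -/
def gapSet (d k : ℕ) {n : ℕ} (c : Composition n) : Set (Fin (numActive d k)) :=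
  {m | ∀ i : Fin c.length, (m : ℕ) ≠ c.sizeUpTo (i + 1) - 1}

/-- The parts of `(p₁^{n₁}, …, p_c^{n_c}, (d-n)^{d-n+k-1})`, where
`p_i = k-1+2d-n_i-2(n₁+⋯+n_{i-1})`; zero parts (which appear if `n = d`) are dropped. -/
def explicitParts (d k : ℕ) {n : ℕ} (c : Composition n) : List ℕ :=
  (List.ofFn fun i : Fin c.length =>
      List.replicate (c.blocksFun i) (k - 1 + 2 * d - c.blocksFun i - 2 * c.sizeUpTo i)).flatten ++
    if n < d then List.replicate (d - n + k - 1) (d - n) else []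

end

end CIJordan

/-! Fix a nonzero linear form `x`, and put `j = 2d+k-3`. For each degree `s` choose a form `g_s`,
not divisible by `x`, such that `x^a g_s` enters `I` for the smallest possible `a`. The nonzero
classes `x^a g_s` form a basis of `A` consisting of Jordan strings, so the Jordan type is the
diagram `P` whose row `s` is the string starting in degree `s` (`isJordanType_of_mem_iff`). The box
`(s, a)` sits in degree `s + a`, hence the diagonal lengths are the Hilbert function, and the rank
of `x^a : A_i → A_{i+a}` counts the boxes of diagonal `i + a` in rows `0, …, i`.

For `I = Ann F` the pairing `(f, g) ↦ (x^a f g) ∘ F` makes these ranks symmetric. Second differences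
of the symmetric counts give an involution on rows: if row `u` ends in degree `j - v`, then row `v`
ends in degree `j - u`. Paired rows have equal length, so the involution reverses each block of
equal rows; a block with first row `a` and last row `b` therefore has rows of length `j + 1 - a -
b`. Thus `P` is known once the last rows of its blocks, the drops, are known. The values of `T` near
degree `d` force the drops outside the active range
(`IsGorensteinDiagram.drop_iff_of_numActive_le`), so the active drops determine `P`.

In characteristic zero `h^i` is nonzero at `x` exactly when `x^(j-2i) : A_i → A_{j-i}` is injective.
Since `dim A_i = i + 1`, this says that rows `0, …, i` all reach diagonal `j - i`, which by the
involution means that `i` is a drop (`IsGorensteinDiagram.forall_mem_iff_drop`). The vanishing set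
is therefore the set of active non-drops and depends only on `P`. This gives injectivity in (a), and
the formula for block lengths gives `Q` in (b).

For surjectivity, when `x` does not divide `u`, the diagram of `(u, x^t v)` is that of `(u, v)` with
a rectangle of height `deg u` and width `t` glued on the left. Iterating realizes every set of
active drops by a complete intersection. Macaulay duality (`exists_annIdeal_eq`) turns ideals into
dual generators `F`; it rests on the socle of a two-generated quotient lying in its top degree. -/

namespace CIJordan

open MvPolynomial

noncomputable section

/-! ### Divisibility by a linear form, tested at its zero. -/

section LinearForms

variable {K : Type*} [Field K]

/-- The zero `(-p₁, p₀)` of the linear form `p₀ x + p₁ y`. -/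
def perp (p : Fin 2 → K) : Fin 2 → K := ![-p 1, p 0]

theorem isHomogeneous_linearForm (p : Fin 2 → K) : (linearForm p).IsHomogeneous 1 :=
  (isHomogeneous_C_mul_X _ _).add (isHomogeneous_C_mul_X _ _)

theorem isHomogeneous_linearForm_pow (p : Fin 2 → K) (n : ℕ) :
    (linearForm p ^ n).IsHomogeneous n := by
  simpa using (isHomogeneous_linearForm p).pow n

@[simp]
theorem eval_perp_linearForm (p : Fin 2 → K) : eval (perp p) (linearForm p) = 0 := by
  simp [linearForm, perp]; ring

theorem exists_eval_perp_linearForm_eq_one {p : Fin 2 → K} (hp : p ≠ 0) :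
    ∃ q : Fin 2 → K, eval (perp p) (linearForm q) = 1 := by
  by_cases h0 : p 0 = 0
  · have h1 : p 1 ≠ 0 := fun h1 => hp (by ext i; fin_cases i <;> simp [h0, h1])
    exact ⟨![-(p 1)⁻¹, 0], by simp [linearForm, perp, h1]⟩
  · exact ⟨![0, (p 0)⁻¹], by simp [linearForm, perp, h0]⟩

theorem IsHomogeneous.aeval_C_mul {f : MvPolynomial (Fin 2) K} {n : ℕ} (hf : f.IsHomogeneous n)
    {S : Type*} [CommRing S] [Algebra K S] (c : Fin 2 → K) (y : S) :
    aeval (fun i => algebraMap K S (c i) * y) f = algebraMap K S (eval c f) * y ^ n := by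
  rw [aeval_def, eval₂_eq', eval_eq', map_sum, Finset.sum_mul]
  refine Finset.sum_congr rfl fun m hm => ?_
  have h := hf.degree_eq_sum_deg_support hm
  simp only [mul_pow, Finset.prod_mul_distrib, map_mul, map_prod, map_pow]
  rw [Finset.prod_pow_eq_pow_sum, mul_assoc]
  congr 3
  rw [h, ← Finset.sum_subset (Finset.subset_univ m.support)]
  intro i _ hi
  simpa using hi

theorem homogeneousComponent_mul_of_isHomogeneous {g : MvPolynomial (Fin 2) K} {e : ℕ}
    (hg : g.IsHomogeneous e) (f : MvPolynomial (Fin 2) K) (n : ℕ) :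
    homogeneousComponent n (f * g) = if e ≤ n then homogeneousComponent (n - e) f * g else 0 := by
  conv_lhs => rw [← sum_homogeneousComponent f, Finset.sum_mul, map_sum]
  have key : ∀ i, homogeneousComponent n (homogeneousComponent i f * g) =
      if i + e = n then homogeneousComponent i f * g else 0 := fun i => by
    rw [homogeneousComponent_of_mem
      ((homogeneousComponent_isHomogeneous i f).mul hg : _ ∈ homogeneousSubmodule _ _ _)]
    simp only [eq_comm]
  simp only [key]
  split_ifs with h
  · rw [Finset.sum_eq_single (n - e)]
    · simp [h]
    · intro b _ hb
      rw [if_neg (by omega)]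
    · intro hb
      rw [homogeneousComponent_eq_zero _ _ (by simp at hb; omega)]
      simp
  · refine Finset.sum_eq_zero fun i _ => if_neg (by omega)

/-- A form of degree `n` is congruent to a multiple of `y ^ n` modulo a linear form `x`, where
`y` is a complementary linear form. -/
theorem IsHomogeneous.sub_mem_span_linearForm {p q : Fin 2 → K}
    (hq : eval (perp p) (linearForm q) = 1) {f : MvPolynomial (Fin 2) K} {n : ℕ}
    (hf : f.IsHomogeneous n) :
    f - C (eval (perp p) f) * linearForm q ^ n ∈ Ideal.span {linearForm p} := by
  have hq' : q 1 * p 0 - q 0 * p 1 = 1 := by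
    simpa [linearForm, perp, sub_eq_add_neg, add_comm] using hq
  rw [← Ideal.Quotient.mk_eq_mk_iff_sub_mem]
  set π := Ideal.Quotient.mkₐ K (Ideal.span {linearForm p}) with hπ
  have hX : ∀ i, π (X i) = algebraMap K _ (perp p i) * π (linearForm q) := by
    -- Modulo `x` each variable is its coordinate at the zero `perp p` times `y`; the cofactors come
    -- from the determinant relation `hq'`.
    intro i
    have hmem : X i - C (perp p i) * linearForm q ∈ Ideal.span {linearForm p} := by
      rw [Ideal.mem_span_singleton]
      have hC : (C (q 1) * C (p 0) - C (q 0) * C (p 1) : MvPolynomial (Fin 2) K) = 1 := by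
        rw [← C_mul, ← C_mul, ← C_sub, hq', C_1]
      fin_cases i
      · refine ⟨C (q 1), ?_⟩
        simp [linearForm, perp]
        linear_combination (-X 0) * hC
      · refine ⟨-C (q 0), ?_⟩
        simp [linearForm, perp]
        linear_combination (-X 1) * hC
    have := Ideal.Quotient.eq.mpr hmem
    rw [map_mul] at this
    exact this
  have h1 : π f = aeval (fun i => π (X i)) f := by
    conv_lhs => rw [← aeval_X_left_apply f]
    rw [← comp_aeval_apply]
  simp only [hX] at h1
  rw [IsHomogeneous.aeval_C_mul hf] at h1
  change π f = π _
  rw [h1, map_mul, map_pow]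
  rfl

theorem IsHomogeneous.exists_eq_linearForm_mul {p : Fin 2 → K} (hp : p ≠ 0)
    {f : MvPolynomial (Fin 2) K} {n : ℕ} (hf : f.IsHomogeneous n) (h0 : eval (perp p) f = 0) :
    ∃ g : MvPolynomial (Fin 2) K, g.IsHomogeneous (n - 1) ∧ f = linearForm p * g := by
  obtain ⟨q, hq⟩ := exists_eval_perp_linearForm_eq_one hp
  have h := IsHomogeneous.sub_mem_span_linearForm hq hf
  rw [h0, C_0, zero_mul, sub_zero, Ideal.mem_span_singleton] at h
  obtain ⟨g, hg⟩ := h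
  have h2 := homogeneousComponent_mul_of_isHomogeneous (isHomogeneous_linearForm p) g n
  rw [mul_comm, ← hg, homogeneousComponent_eq_self hf] at h2
  by_cases hn : 1 ≤ n
  · rw [if_pos hn] at h2
    exact ⟨_, homogeneousComponent_isHomogeneous (n - 1) g, by rw [mul_comm]; exact h2⟩
  -- In degree `0` the exponent `n - 1` truncates, but then `f = 0`.
  · rw [if_neg hn] at h2
    exact ⟨0, isHomogeneous_zero _ _ _, by rw [h2, mul_zero]⟩

end LinearForms

/-! ### String generators attached to a linear form. -/

section Strings

variable {K : Type*} [Field K]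

/-- Some form `g` of degree `s` not divisible by `x = p₀ x + p₁ y` has `x ^ a * g ∈ I`. -/
def Reduces (I : Ideal (MvPolynomial (Fin 2) K)) (p : Fin 2 → K) (s a : ℕ) : Prop :=
  ∃ g : MvPolynomial (Fin 2) K, g.IsHomogeneous s ∧ eval (perp p) g ≠ 0 ∧
    linearForm p ^ a * g ∈ I

variable {I : Ideal (MvPolynomial (Fin 2) K)} {p : Fin 2 → K}

theorem Reduces.mono (hp : p ≠ 0) {s a s' a' : ℕ} (h : Reduces I p s a) (hs : s ≤ s')
    (ha : a ≤ a') : Reduces I p s' a' := by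
  obtain ⟨g, hg, h0, hI⟩ := h
  obtain ⟨q, hq⟩ := exists_eval_perp_linearForm_eq_one hp
  refine ⟨linearForm q ^ (s' - s) * g, ?_, ?_, ?_⟩
  · have := (isHomogeneous_linearForm_pow q (s' - s)).mul hg
    rwa [Nat.sub_add_cancel hs] at this
  · simp [hq, h0]
  · have : linearForm p ^ a' * (linearForm q ^ (s' - s) * g) =
        (linearForm p ^ (a' - a) * linearForm q ^ (s' - s)) * (linearForm p ^ a * g) := by
      rw [← Nat.sub_add_cancel ha, pow_add]
      simp only [Nat.add_sub_cancel]
      ring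
    rw [this]
    exact I.mul_mem_left _ hI

/-- Forms `g s` of degree `s`, monic modulo `x = p₀ x + p₁ y`, whose products with powers of `x`
lie in `I` as soon as possible. -/
structure IsStringGenerator (I : Ideal (MvPolynomial (Fin 2) K)) (p : Fin 2 → K)
    (g : ℕ → MvPolynomial (Fin 2) K) : Prop where
  isHomogeneous : ∀ s, (g s).IsHomogeneous s
  eval_perp_ne_zero : ∀ s, eval (perp p) (g s) ≠ 0
  mem : ∀ s a, Reduces I p s a → linearForm p ^ a * g s ∈ I

theorem exists_isStringGenerator (I : Ideal (MvPolynomial (Fin 2) K)) (hp : p ≠ 0) :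
    ∃ g, IsStringGenerator I p g := by
  classical
  have : ∀ s, ∃ g : MvPolynomial (Fin 2) K, g.IsHomogeneous s ∧ eval (perp p) g ≠ 0 ∧
      ∀ a, Reduces I p s a → linearForm p ^ a * g ∈ I := by
    intro s
    by_cases h : ∃ a, Reduces I p s a
    · obtain ⟨g, hg, h0, hI⟩ := Nat.find_spec h
      refine ⟨g, hg, h0, fun a ha => ?_⟩
      rw [← Nat.sub_add_cancel (Nat.find_min' h ha), pow_add, mul_assoc]
      exact I.mul_mem_left _ hI
    · push Not at h
      obtain ⟨q, hq⟩ := exists_eval_perp_linearForm_eq_one hp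
      exact ⟨linearForm q ^ s, isHomogeneous_linearForm_pow q s, by simp [hq],
        fun a ha => absurd ha (h a)⟩
  choose g h1 h2 h3 using this
  exact ⟨g, h1, h2, h3⟩

variable {g : ℕ → MvPolynomial (Fin 2) K}

theorem IsStringGenerator.isHomogeneous_pow_mul (hg : IsStringGenerator I p g) (s a : ℕ) :
    (linearForm p ^ a * g s).IsHomogeneous (s + a) := by
  rw [add_comm]
  exact (isHomogeneous_linearForm_pow p a).mul (hg.isHomogeneous s)

/-- Modulo `x` the forms of degree `i` are a line spanned by `g i`. Subtracting a multiple of `g i`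
leaves a multiple of `x`, and induction on the degree applies to the quotient. -/
theorem IsStringGenerator.homogeneousSubmodule_eq_span (hp : p ≠ 0)
    (hg : IsStringGenerator I p g) (i : ℕ) :
    homogeneousSubmodule (Fin 2) K i =
      Submodule.span K ((fun s => linearForm p ^ (i - s) * g s) '' Set.Iic i) := by
  apply le_antisymm
  · induction i with
    | zero =>
      intro f hf
      rw [mem_homogeneousSubmodule] at hf
      obtain ⟨h, -, hh⟩ := IsHomogeneous.exists_eq_linearForm_mul hp
        (f := f - C (eval (perp p) f / eval (perp p) (g 0)) * g 0)
        (hf.sub (by simpa using (isHomogeneous_C _ _).mul (hg.isHomogeneous 0)))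
        (by simp [hg.eval_perp_ne_zero 0])
      have hz : f - C (eval (perp p) f / eval (perp p) (g 0)) * g 0 = 0 := by
        have hf' := hf.sub (((hg.isHomogeneous 0).C_mul
          (eval (perp p) f / eval (perp p) (g 0))))
        rw [← totalDegree_zero_iff_isHomogeneous, totalDegree_eq_zero_iff_eq_C] at hf'
        have h3 := congrArg (eval (perp p)) hf'
        rw [hh, map_mul, eval_perp_linearForm, zero_mul, eval_C] at h3
        rw [hf', hh, ← h3, C_0]
      rw [sub_eq_zero] at hz
      rw [hz, ← smul_eq_C_mul]
      exact Submodule.smul_mem _ _ (Submodule.subset_span ⟨0, by simp, by simp⟩)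
    | succ i ih =>
      intro f hf
      rw [mem_homogeneousSubmodule] at hf
      obtain ⟨h, hh1, hh⟩ := IsHomogeneous.exists_eq_linearForm_mul hp
        (f := f - C (eval (perp p) f / eval (perp p) (g (i + 1))) * g (i + 1))
        (hf.sub ((hg.isHomogeneous _).C_mul _))
        (by simp [hg.eval_perp_ne_zero (i + 1)])
      rw [sub_eq_iff_eq_add] at hh
      rw [hh]
      refine Submodule.add_mem _ ?_ ?_
      · have h4 := ih hh1
        have h5 := Submodule.mem_map_of_mem (f := LinearMap.mulLeft K (linearForm p)) h4
        rw [Submodule.map_span, LinearMap.mulLeft_apply] at h5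
        refine Submodule.span_mono ?_ h5
        rintro _ ⟨_, ⟨s, hs, rfl⟩, rfl⟩
        refine ⟨s, Set.mem_Iic.2 (Nat.le_succ_of_le hs), ?_⟩
        simp only [LinearMap.mulLeft_apply]
        rw [← mul_assoc, ← pow_succ', Nat.succ_sub hs]
      · rw [← smul_eq_C_mul]
        exact Submodule.smul_mem _ _ (Submodule.subset_span ⟨i + 1, by simp, by simp⟩)
  · rw [Submodule.span_le]
    rintro _ ⟨s, hs, rfl⟩
    have := hg.isHomogeneous_pow_mul s (i - s)
    rw [Nat.add_sub_cancel' hs] at this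
    exact this

/-- In a nontrivial relation let `m` be the largest index with nonzero coefficient and factor out
`x^(i-m)`. The cofactor has degree `m` and is a nonzero multiple of `g m` modulo `x`, so it
witnesses `Reduces I p m (i - m)`, which is excluded. -/
theorem IsStringGenerator.eq_zero_of_sum_mem (hg : IsStringGenerator I p g) {i : ℕ}
    (t : Finset ℕ) (w : ℕ → K) (ht : ∀ s ∈ t, s ≤ i ∧ ¬ Reduces I p s (i - s))
    (hsum : ∑ s ∈ t, w s • (linearForm p ^ (i - s) * g s) ∈ I) : ∀ s ∈ t, w s = 0 := by
  classical
  by_contra! hne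
  have hne' : (t.filter fun s => w s ≠ 0).Nonempty := by
    obtain ⟨s, hs, h⟩ := hne
    exact ⟨s, by simp [hs, h]⟩
  obtain ⟨m, hm, hmax⟩ := Finset.exists_max_image _ id hne'
  rw [Finset.mem_filter] at hm
  have hmi := (ht m hm.1).1
  apply (ht m hm.1).2
  refine ⟨∑ s ∈ t.filter (fun s => w s ≠ 0), w s • (linearForm p ^ (m - s) * g s), ?_, ?_, ?_⟩
  · refine IsHomogeneous.sum _ _ _ fun s hs => ?_
    have hs' : s ≤ m := hmax s hs
    have := hg.isHomogeneous_pow_mul s (m - s)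
    rw [Nat.add_sub_cancel' hs'] at this
    rw [smul_eq_C_mul]
    exact this.C_mul _
  · rw [map_sum, Finset.sum_eq_single m]
    · simp [smul_eval, hm.2, hg.eval_perp_ne_zero m]
    · intro s hs hsm
      have hs' : s ≤ m := hmax s hs
      rw [smul_eval, map_mul, map_pow, eval_perp_linearForm, zero_pow (by omega)]
      simp
    · intro h
      exact absurd (Finset.mem_filter.2 hm) h
  · rw [← Finset.sum_filter_add_sum_filter_not t (fun s => w s ≠ 0)] at hsum
    rw [Finset.sum_eq_zero (s := t.filter fun s => ¬ w s ≠ 0)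
      (fun s hs => by simp only [Finset.mem_filter, not_not] at hs; rw [hs.2, zero_smul]),
      add_zero] at hsum
    convert hsum using 1
    rw [Finset.mul_sum]
    refine Finset.sum_congr rfl fun s hs => ?_
    have hs' : s ≤ m := hmax s hs
    rw [mul_smul_comm, ← mul_assoc, ← pow_add]
    congr 4
    omega

end Strings

/-! ### The Jordan basis, ranks of powers, and the Hilbert function. -/

section Dimensions

variable {K : Type*} [Field K] {I : Ideal (MvPolynomial (Fin 2) K)} {p : Fin 2 → K}
  {g : ℕ → MvPolynomial (Fin 2) K}

theorem mulLinear_pow_mk (I : Ideal (MvPolynomial (Fin 2) K)) (p : Fin 2 → K) (a : ℕ)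
    (f : MvPolynomial (Fin 2) K) :
    (mulLinear I p ^ a) (Ideal.Quotient.mk I f) = Ideal.Quotient.mk I (linearForm p ^ a * f) := by
  rw [mulLinear, LinearMap.pow_mulLeft, LinearMap.mulLeft_apply, map_mul, map_pow]

open Classical in
/-- The rank of `x ^ a : A_i → A_{i+a}` is the number of boxes on the diagonal `i + a` in the
rows `0, …, i` of the diagram of pairs not satisfying `Reduces`. -/
theorem finrank_map_mulLinear_pow (I : Ideal (MvPolynomial (Fin 2) K)) (hp : p ≠ 0) (i a : ℕ) :
    Module.finrank K ((gradedPiece I i).map (mulLinear I p ^ a)) =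
      ((Finset.range (i + 1)).filter fun s => ¬ Reduces I p s (i + a - s)).card := by
  obtain ⟨g, hg⟩ := exists_isStringGenerator I hp
  set t := (Finset.range (i + 1)).filter fun s => ¬ Reduces I p s (i + a - s) with ht
  let b : t → MvPolynomial (Fin 2) K ⧸ I :=
    fun s => Ideal.Quotient.mk I (linearForm p ^ (i + a - s) * g s)
  have hb : LinearIndependent K b := by
    have : LinearIndepOn K (fun s : ℕ =>
        Ideal.Quotient.mk I (linearForm p ^ (i + a - s) * g s)) (t : Set ℕ) := by
      rw [linearIndepOn_finset_iff]
      intro w hw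
      refine hg.eq_zero_of_sum_mem (i := i + a) t w (fun s hs => ?_) ?_
      · simp only [ht, Finset.mem_filter, Finset.mem_range] at hs
        exact ⟨by omega, hs.2⟩
      · rw [← Ideal.Quotient.eq_zero_iff_mem, map_sum]
        exact hw
    exact this
  -- Multiplying the spanning family of degree `i` by `x^a` only raises the exponents, so the image
  -- involves the strings starting in degrees at most `i`.
  have h1 : (gradedPiece I i).map (mulLinear I p ^ a) = Submodule.span K
      ((fun s => Ideal.Quotient.mk I (linearForm p ^ (i + a - s) * g s)) '' Set.Iic i) := by
    rw [gradedPiece, hg.homogeneousSubmodule_eq_span hp i, Submodule.map_span, Submodule.map_span,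
      Set.image_image, Set.image_image]
    congr 1
    refine Set.image_congr fun s hs => ?_
    change (mulLinear I p ^ a) (Ideal.Quotient.mk I _) = _
    rw [mulLinear_pow_mk, ← mul_assoc, ← pow_add]
    congr 4
    have : s ≤ i := hs
    omega
  suffices h2 : (gradedPiece I i).map (mulLinear I p ^ a) = Submodule.span K (Set.range b) by
    rw [h2, finrank_span_eq_card hb, Fintype.card_coe]
  rw [h1]
  apply le_antisymm
  · rw [Submodule.span_le]
    rintro _ ⟨s, hs, rfl⟩
    have hs' : s ≤ i := hs
    by_cases hr : Reduces I p s (i + a - s)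
    · have := Ideal.Quotient.eq_zero_iff_mem.2 (hg.mem _ _ hr)
      simp only [this]
      exact Submodule.zero_mem _
    · exact Submodule.subset_span ⟨⟨s, by simp [ht, hr]; omega⟩, rfl⟩
  · rw [Submodule.span_le]
    rintro _ ⟨⟨s, hs⟩, rfl⟩
    simp only [ht, Finset.mem_filter, Finset.mem_range] at hs
    exact Submodule.subset_span ⟨s, by simp; omega, rfl⟩

open Classical in
theorem hilbertFunction_eq_card (I : Ideal (MvPolynomial (Fin 2) K)) (hp : p ≠ 0) (i : ℕ) :
    hilbertFunction I i =
      ((Finset.range (i + 1)).filter fun s => ¬ Reduces I p s (i - s)).card := by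
  have := finrank_map_mulLinear_pow I hp i 0
  rw [pow_zero, Module.End.one_eq_id, Submodule.map_id] at this
  exact this

theorem mem_of_hilbertFunction_eq_zero {n : ℕ} (h : hilbertFunction I n = 0)
    {f : MvPolynomial (Fin 2) K} (hf : f.IsHomogeneous n) : f ∈ I := by
  rw [hilbertFunction, Submodule.finrank_eq_zero] at h
  have : Ideal.Quotient.mk I f ∈ gradedPiece I n := ⟨f, hf, rfl⟩
  rw [h, Submodule.mem_bot] at this
  exact Ideal.Quotient.eq_zero_iff_mem.1 this

theorem reduces_of_hilbertFunction_eq_zero (hp : p ≠ 0) {s a : ℕ}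
    (h : hilbertFunction I (s + a) = 0) : Reduces I p s a := by
  obtain ⟨g, hg⟩ := exists_isStringGenerator I hp
  exact ⟨g s, hg.isHomogeneous s, hg.eval_perp_ne_zero s,
    mem_of_hilbertFunction_eq_zero h (hg.isHomogeneous_pow_mul s a)⟩

/-- The pairs not satisfying `Reduces` are the boxes of a Ferrers diagram. -/
theorem exists_youngDiagram (hp : p ≠ 0) {J : ℕ} (hJ : ∀ i, J < i → hilbertFunction I i = 0) :
    ∃ P : YoungDiagram, ∀ s a, (s, a) ∈ P ↔ ¬ Reduces I p s a := by
  classical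
  let t := (Finset.range (J + 1) ×ˢ Finset.range (J + 1)).filter fun c => ¬ Reduces I p c.1 c.2
  have ht : ∀ c, c ∈ t ↔ ¬ Reduces I p c.1 c.2 := fun c => by
    simp only [t, Finset.mem_filter, Finset.mem_product, Finset.mem_range, and_iff_right_iff_imp]
    intro h
    by_contra hlt
    exact h (reduces_of_hilbertFunction_eq_zero hp (hJ _ (by omega)))
  have hl : IsLowerSet (t : Set (ℕ × ℕ)) := fun c c' hle hc => by
    rw [Finset.mem_coe, ht] at hc ⊢
    exact fun h => hc (h.mono hp hle.1 hle.2)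
  exact ⟨⟨t, hl⟩, fun s a => ht (s, a)⟩

/-- Homogeneity of `I` splits a relation into its diagonals, and each diagonal is handled by
`IsStringGenerator.eq_zero_of_sum_mem`. -/
theorem IsStringGenerator.linearIndepOn (hg : IsStringGenerator I p g)
    (hI : ∀ n, ∀ f ∈ I, homogeneousComponent n f ∈ I) {P : YoungDiagram}
    (hP : ∀ s a, (s, a) ∈ P ↔ ¬ Reduces I p s a) :
    LinearIndepOn K (fun c : ℕ × ℕ => Ideal.Quotient.mk I (linearForm p ^ c.2 * g c.1))
      (P.cells : Set (ℕ × ℕ)) := by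
  classical
  rw [linearIndepOn_finset_iff]
  intro w hw c hc
  have h1 : ∑ c ∈ P.cells, w c • (linearForm p ^ c.2 * g c.1) ∈ I := by
    rw [← Ideal.Quotient.eq_zero_iff_mem, map_sum]
    exact hw
  have h2 := hI (c.1 + c.2) _ h1
  set i := c.1 + c.2 with hi
  have h3 : homogeneousComponent i (∑ c ∈ P.cells, w c • (linearForm p ^ c.2 * g c.1)) =
      ∑ s ∈ (Finset.range (i + 1)).filter (fun s => (s, i - s) ∈ P),
        w (s, i - s) • (linearForm p ^ (i - s) * g s) := by
    rw [map_sum]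
    have : ∀ c ∈ P.cells, homogeneousComponent i (w c • (linearForm p ^ c.2 * g c.1)) =
        if c.1 + c.2 = i then w c • (linearForm p ^ c.2 * g c.1) else 0 := fun c _ => by
      rw [map_smul, homogeneousComponent_of_mem (hg.isHomogeneous_pow_mul c.1 c.2)]
      by_cases h : c.1 + c.2 = i
      · simp [h]
      · simp [h, Ne.symm h]
    rw [Finset.sum_congr rfl this, ← Finset.sum_filter]
    refine Finset.sum_bij' (fun c _ => c.1) (fun s _ => (s, i - s)) ?_ ?_ ?_ ?_ ?_
    · rintro ⟨s, a⟩ h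
      simp only [Finset.mem_filter, YoungDiagram.mem_cells, Finset.mem_range] at h ⊢
      rw [show i - s = a by omega]
      exact ⟨by omega, h.1⟩
    · intro s h
      simp only [Finset.mem_filter, YoungDiagram.mem_cells, Finset.mem_range] at h ⊢
      exact ⟨h.2, by omega⟩
    · rintro ⟨s, a⟩ h
      simp only [Finset.mem_filter] at h
      simp; omega
    · intros; rfl
    · rintro ⟨s, a⟩ h
      simp only [Finset.mem_filter] at h
      simp [show i - s = a by omega]
  rw [h3] at h2
  have h4 := hg.eq_zero_of_sum_mem _ (fun s => w (s, i - s)) (fun s hs => ?_) h2 c.1 ?_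
  · simpa [hi] using h4
  · simp only [Finset.mem_filter, Finset.mem_range] at hs
    exact ⟨by omega, (hP _ _).1 hs.2⟩
  · simp only [Finset.mem_filter, Finset.mem_range]
    refine ⟨by omega, ?_⟩
    rw [show i - c.1 = c.2 by omega]
    exact hc

theorem IsStringGenerator.top_le_span (hp : p ≠ 0) (hg : IsStringGenerator I p g)
    {P : YoungDiagram} (hP : ∀ s a, (s, a) ∈ P ↔ ¬ Reduces I p s a) :
    ⊤ ≤ Submodule.span K (Set.range fun c : {c : ℕ × ℕ // c ∈ P} =>
      Ideal.Quotient.mk I (linearForm p ^ c.1.2 * g c.1.1)) := by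
  rintro z -
  obtain ⟨f, rfl⟩ := Ideal.Quotient.mk_surjective z
  rw [← sum_homogeneousComponent f, map_sum]
  refine Submodule.sum_mem _ fun i _ => ?_
  have h1 : homogeneousComponent i f ∈ homogeneousSubmodule (Fin 2) K i :=
    homogeneousComponent_mem i f
  rw [hg.homogeneousSubmodule_eq_span hp i] at h1
  have h2 := Submodule.mem_map_of_mem (f := (Ideal.Quotient.mkₐ K I).toLinearMap) h1
  rw [Submodule.map_span] at h2
  refine Submodule.span_le.2 ?_ h2
  rintro _ ⟨_, ⟨s, -, rfl⟩, rfl⟩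
  change Ideal.Quotient.mk I (linearForm p ^ (i - s) * g s) ∈ _
  by_cases h : (s, i - s) ∈ P
  · exact Submodule.subset_span ⟨⟨_, h⟩, rfl⟩
  · have h3 : Ideal.Quotient.mk I (linearForm p ^ (i - s) * g s) = 0 := by
      refine Ideal.Quotient.eq_zero_iff_mem.2 (hg.mem _ _ ?_)
      by_contra h'
      exact h ((hP _ _).2 h')
    rw [h3]
    exact Submodule.zero_mem _

theorem isJordanType_of_mem_iff (hp : p ≠ 0)
    (hI : ∀ n, ∀ f ∈ I, homogeneousComponent n f ∈ I) {P : YoungDiagram}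
    (hP : ∀ s a, (s, a) ∈ P ↔ ¬ Reduces I p s a) : IsJordanType (mulLinear I p) P := by
  obtain ⟨g, hg⟩ := exists_isStringGenerator I hp
  have hli : LinearIndependent K (fun c : {c : ℕ × ℕ // c ∈ P} =>
      Ideal.Quotient.mk I (linearForm p ^ c.1.2 * g c.1.1)) :=
    (hg.linearIndepOn hI hP : LinearIndependent K _).comp
      (fun c : {c : ℕ × ℕ // c ∈ P} => (⟨c.1, c.2⟩ : (P.cells : Set (ℕ × ℕ))))
      (fun c c' h => Subtype.ext (congrArg (fun x => x.1) h))
  refine ⟨Module.Basis.mk hli (hg.top_le_span hp hP), fun c => ?_⟩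
  simp only [Module.Basis.mk_apply]
  have h1 := mulLinear_pow_mk I p 1 (linearForm p ^ c.1.2 * g c.1.1)
  rw [pow_one, pow_one, ← mul_assoc, ← pow_succ'] at h1
  rw [h1]
  split_ifs with h
  · rfl
  · refine Ideal.Quotient.eq_zero_iff_mem.2 (hg.mem _ _ ?_)
    by_contra h'
    exact h ((hP _ _).2 h')

end Dimensions

/-! ### A Jordan type is determined by the endomorphism. -/

section Uniqueness

variable {K V : Type*} [Field K] [AddCommGroup V] [Module K V] {φ : Module.End K V}

theorem IsJordanType.finrank_range_pow {P : YoungDiagram} (h : IsJordanType φ P) (a : ℕ) :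
    Module.finrank K (LinearMap.range (φ ^ a)) = (P.cells.filter fun c => a ≤ c.2).card := by
  classical
  obtain ⟨b, hb⟩ := h
  have hpow : ∀ (n : ℕ) (c : {c : ℕ × ℕ // c ∈ P}),
      (φ ^ n) (b c) = if h : (c.1.1, c.1.2 + n) ∈ P then b ⟨(c.1.1, c.1.2 + n), h⟩ else 0 := by
    intro n
    induction n with
    | zero => intro c; simp [c.2]
    | succ n ih =>
      intro c
      rw [pow_succ', Module.End.mul_apply, ih]
      by_cases h : (c.1.1, c.1.2 + n) ∈ P
      · rw [dif_pos h, hb]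
        rfl
      · rw [dif_neg h, map_zero, dif_neg]
        exact fun h' => h (P.up_left_mem le_rfl (by omega) h')
  set t := P.cells.filter fun c => a ≤ c.2 with ht
  let v : t → V := fun c => b ⟨c.1, (Finset.mem_filter.1 c.2).1⟩
  have hv : LinearIndependent K v := b.linearIndependent.comp _
    (fun c c' h => Subtype.ext (congrArg (fun x => x.1) h))
  suffices h2 : LinearMap.range (φ ^ a) = Submodule.span K (Set.range v) by
    rw [h2, finrank_span_eq_card hv, Fintype.card_coe]
  rw [LinearMap.range_eq_map, ← b.span_eq, Submodule.map_span, ← Set.range_comp]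
  apply le_antisymm
  · rw [Submodule.span_le]
    rintro _ ⟨c, rfl⟩
    simp only [Function.comp_apply, hpow, SetLike.mem_coe]
    split_ifs with h
    · exact Submodule.subset_span ⟨⟨(c.1.1, c.1.2 + a), by simp [ht, h]⟩, rfl⟩
    · exact Submodule.zero_mem _
  · rw [Submodule.span_le]
    rintro _ ⟨⟨⟨s, c⟩, hc⟩, rfl⟩
    simp only [ht, Finset.mem_filter, YoungDiagram.mem_cells] at hc
    refine Submodule.subset_span ⟨⟨(s, c - a), P.up_left_mem le_rfl (by omega) hc.1⟩, ?_⟩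
    simp only [Function.comp_apply, hpow, v]
    have h : c - a + a = c := by omega
    rw [dif_pos (by rw [h]; exact hc.1)]
    simp only [h]

/-- The column lengths are the successive differences of the ranks of the powers of `φ`. -/
theorem IsJordanType.unique {P P' : YoungDiagram} (h : IsJordanType φ P)
    (h' : IsJordanType φ P') : P = P' := by
  have hcard : ∀ (P : YoungDiagram), IsJordanType φ P → ∀ a, P.colLen a =
      Module.finrank K (LinearMap.range (φ ^ a)) -
        Module.finrank K (LinearMap.range (φ ^ (a + 1))) := by
    intro P h a
    rw [h.finrank_range_pow, h.finrank_range_pow, YoungDiagram.colLen_eq_card]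
    have : P.cells.filter (fun c => a ≤ c.2) =
        P.col a ∪ P.cells.filter (fun c => a + 1 ≤ c.2) := by
      ext c
      simp only [Finset.mem_filter, Finset.mem_union, YoungDiagram.mem_cells,
        YoungDiagram.mem_col_iff]
      constructor
      · rintro ⟨h1, h2⟩
        rcases h2.eq_or_lt with h3 | h3
        · exact Or.inl ⟨h1, h3.symm⟩
        · exact Or.inr ⟨h1, h3⟩
      · rintro (⟨h1, h2⟩ | ⟨h1, h2⟩)
        · exact ⟨h1, h2.ge⟩
        · exact ⟨h1, by omega⟩
    rw [this, Finset.card_union_of_disjoint]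
    · omega
    · rw [Finset.disjoint_left]
      intro c hc hc'
      rw [YoungDiagram.mem_col_iff] at hc
      rw [Finset.mem_filter] at hc'
      omega
  ext ⟨s, a⟩
  rw [YoungDiagram.mem_cells, YoungDiagram.mem_cells, YoungDiagram.mem_iff_lt_colLen,
    YoungDiagram.mem_iff_lt_colLen, hcard P h, hcard P' h']

end Uniqueness

/-! ### Combinatorics of symmetric diagrams. -/

section Diagrams

/-- The combinatorial properties of the Jordan type of a linear form on a graded Gorenstein
quotient of `K[x,y]` of Hilbert function `T(d,k)`. -/
structure IsGorensteinDiagram (d k : ℕ) (P : YoungDiagram) : Prop where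
  add_le : ∀ s a, (s, a) ∈ P → s + a ≤ 2 * d + k - 3
  symm : ∀ u v, u + v ≤ 2 * d + k - 3 →
    ((Finset.range (u + 1)).filter fun s => (s, 2 * d + k - 3 - v - s) ∈ P).card =
      ((Finset.range (v + 1)).filter fun s => (s, 2 * d + k - 3 - u - s) ∈ P).card
  card_eq : ∀ i, ((Finset.range (i + 1)).filter fun s => (s, i - s) ∈ P).card = seqT d k i

theorem rowLen_eq_of_forall_not_drop {P : YoungDiagram} {a b : ℕ} (hab : a ≤ b)
    (h : ∀ i, a ≤ i → i < b → ¬ P.rowLen (i + 1) < P.rowLen i) : P.rowLen b = P.rowLen a := by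
  induction b, hab using Nat.le_induction with
  | base => rfl
  | succ b hb ih =>
    rw [← ih fun i h1 h2 => h i h1 (by omega)]
    exact le_antisymm (P.rowLen_anti _ _ (by omega)) (not_lt.1 (h b hb (by omega)))

theorem exists_drop_of_rowLen_pos {P : YoungDiagram} {s : ℕ} (hs : 0 < P.rowLen s) :
    ∃ b, s ≤ b ∧ P.rowLen (b + 1) < P.rowLen b := by
  by_contra! h
  have h1 : ∀ b, s ≤ b → P.rowLen b = P.rowLen s := fun b hb =>
    rowLen_eq_of_forall_not_drop hb fun i hi _ => not_lt.2 (h i hi)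
  have h2 : (s + P.colLen 0, 0) ∈ P := by
    rw [YoungDiagram.mem_iff_lt_rowLen, h1 _ (by omega)]
    exact hs
  rw [YoungDiagram.mem_iff_lt_colLen] at h2
  omega

namespace IsGorensteinDiagram

variable {d k : ℕ} {P : YoungDiagram}

theorem rowLen_add_le (h : IsGorensteinDiagram d k P) {s : ℕ} (hs : 0 < P.rowLen s) :
    P.rowLen s + s ≤ 2 * d + k - 3 + 1 := by
  have := h.add_le s (P.rowLen s - 1) (YoungDiagram.mem_iff_lt_rowLen.2 (by omega))
  omega

/-- The number of boxes on the diagonal `2d+k-2-v` in the first `u` rows is symmetric. -/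
theorem card_filter_range_symm (h : IsGorensteinDiagram d k P) {u v : ℕ}
    (huv : u + v ≤ 2 * d + k - 3 + 2) :
    ((Finset.range u).filter fun s => (s, 2 * d + k - 3 + 1 - v - s) ∈ P).card =
      ((Finset.range v).filter fun s => (s, 2 * d + k - 3 + 1 - u - s) ∈ P).card := by
  have h0 : ∀ u, ((Finset.range u).filter fun s => (s, 2 * d + k - 3 + 1 - 0 - s) ∈ P).card = 0 := by
    intro u
    rw [Finset.card_eq_zero, Finset.filter_eq_empty_iff]
    intro s _ hs
    have := h.add_le _ _ hs
    omega
  rcases u with _ | u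
  · rw [h0]; simp
  · rcases v with _ | v
    · rw [h0]; simp
    · have := h.symm u v (by omega)
      have e : ∀ w, 2 * d + k - 3 + 1 - (w + 1) = 2 * d + k - 3 - w := fun w => by omega
      rw [e, e]
      exact this

/-- If the string starting in degree `u` has codegree `v` at its end, then the string starting in
degree `v` has codegree `u` at its end. -/
theorem involution (h : IsGorensteinDiagram d k P) {u v : ℕ} (hu : 0 < P.rowLen u)
    (huv : P.rowLen u + u + v = 2 * d + k - 3 + 1) :
    0 < P.rowLen v ∧ P.rowLen v + v + u = 2 * d + k - 3 + 1 := by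
  -- The second difference of the counts in `u` and `v` is `1` exactly when row `u` reaches degree
  -- `j - v` but not `j - v + 1`, where `j = 2d+k-3`. Symmetry of the four counts transfers this to
  -- row `v`.
  have step : ∀ u v, ((Finset.range (u + 1)).filter fun s =>
      (s, 2 * d + k - 3 + 1 - v - s) ∈ P).card =
      ((Finset.range u).filter fun s => (s, 2 * d + k - 3 + 1 - v - s) ∈ P).card +
        if 2 * d + k - 3 + 1 - v - u < P.rowLen u then 1 else 0 := by
    intro u v
    rw [Finset.range_add_one, Finset.filter_insert]
    simp only [← YoungDiagram.mem_iff_lt_rowLen]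
    split_ifs with hm
    · rw [Finset.card_insert_of_notMem (by simp)]
    · rfl
  have h1 := h.card_filter_range_symm (u := u + 1) (v := v + 1) (by omega)
  have h2 := h.card_filter_range_symm (u := u) (v := v + 1) (by omega)
  have h3 := h.card_filter_range_symm (u := u + 1) (v := v) (by omega)
  have h4 := h.card_filter_range_symm (u := u) (v := v) (by omega)
  have s1 := step u (v + 1)
  have s2 := step u v
  have s3 := step v (u + 1)
  have s4 := step v u
  split_ifs at s1 s2 s3 s4 <;> omega

/-- The strings starting in degrees `≤ i` end in codegrees `≤ i`, when `i` is the end of a block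
of rows of equal lengths. -/
theorem le_of_drop (h : IsGorensteinDiagram d k P) {i s : ℕ} (hi : P.rowLen (i + 1) < P.rowLen i)
    (hs : s ≤ i) : 2 * d + k - 3 + 1 ≤ P.rowLen s + s + i := by
  have h1 := P.rowLen_anti s i hs
  have h2 := h.rowLen_add_le (s := s) (by omega)
  obtain ⟨v, hv⟩ := Nat.exists_eq_add_of_le h2
  by_contra hlt
  -- Paired rows `s` and `v` have the same length, impossible if the drop at `i` lies between them.
  have h3 := h.involution (u := s) (v := v) (by omega) (by omega)
  have h4 := P.rowLen_anti (i + 1) v (by omega)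
  omega

/-- A drop at `i` keeps the partners of rows `s ≤ i` at most `i`, so these rows reach diagonal `j -
i`, where `j = 2d+k-3`. If instead rows `i` and `i + 1` have equal length, the partner of row `i +
1` is a row below index `i` ending in degree `j - i - 1`, one step short. -/
theorem forall_mem_iff_drop (h : IsGorensteinDiagram d k P) {i : ℕ}
    (hi : 2 * i ≤ 2 * d + k - 3) :
    (∀ s ≤ i, (s, 2 * d + k - 3 - i - s) ∈ P) ↔ P.rowLen (i + 1) < P.rowLen i := by
  simp only [YoungDiagram.mem_iff_lt_rowLen]
  constructor
  · intro hall
    by_contra hlt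
    have h1 := hall i le_rfl
    have h0 := P.rowLen_anti i (i + 1) (by omega)
    have h2 := h.rowLen_add_le (s := i + 1) (by omega)
    obtain ⟨w, hw⟩ := Nat.exists_eq_add_of_le h2
    have h3 := h.involution (u := i + 1) (v := w) (by omega) (by omega)
    have h4 := hall w (by omega)
    omega
  · intro hd s hs
    have := h.le_of_drop hd hs
    omega

/-- The common length of the rows of a block, in terms of its first and last row. -/
theorem rowLen_add_add_eq (h : IsGorensteinDiagram d k P) {a b : ℕ}
    (ha : a = 0 ∨ P.rowLen a < P.rowLen (a - 1)) (hab : a ≤ b) (hl : P.rowLen b = P.rowLen a)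
    (hb : P.rowLen (b + 1) < P.rowLen b) : P.rowLen a + a + b = 2 * d + k - 3 + 1 := by
  have h1 := h.le_of_drop hb hab
  have h2 := h.rowLen_add_le (s := b) (by omega)
  obtain ⟨v, hv⟩ := Nat.exists_eq_add_of_le h2
  have h3 := h.involution (u := b) (v := v) (by omega) (by omega)
  -- Otherwise the partner of the last row `b` would precede the block, where the rows are strictly
  -- longer.
  by_contra hne
  have h4 : v < a := by omega
  have h5 := P.rowLen_anti v (a - 1) (by omega)
  omega

/-- Since `T_{d-1} = d`, diagonal `d - 1` is full. -/
theorem le_rowLen_add (h : IsGorensteinDiagram d k P) (hk : 1 ≤ k) {s : ℕ} (hs : s < d) :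
    d ≤ P.rowLen s + s := by
  have h1 := h.card_eq (d - 1)
  have h2 : seqT d k (d - 1) = (Finset.range (d - 1 + 1)).card := by
    rw [Finset.card_range, seqT]; omega
  rw [h2, Finset.card_filter_eq_iff] at h1
  have := h1 s (by simp; omega)
  rw [YoungDiagram.mem_iff_lt_rowLen] at this
  omega

/-- Since `T_d = d`, diagonal `d` misses one of its `d + 1` places. The row missing there is not row
`d`, and as diagonal `d - 1` is full it ends in degree exactly `d - 1`. -/
theorem exists_rowLen_eq (h : IsGorensteinDiagram d k P) (hk : 2 ≤ k) (hd : 0 < P.rowLen d) :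
    ∃ s < d, P.rowLen s = d - s := by
  have h1 := h.card_eq d
  have h2 : seqT d k d ≠ (Finset.range (d + 1)).card := by
    rw [Finset.card_range, seqT]; omega
  rw [← h1, Ne, Finset.card_filter_eq_iff] at h2
  push Not at h2
  obtain ⟨s, hs, hsP⟩ := h2
  rw [YoungDiagram.mem_iff_lt_rowLen] at hsP
  rw [Finset.mem_range] at hs
  have h3 : s ≠ d := by rintro rfl; omega
  have h4 := h.le_rowLen_add (by omega) (s := s) (by omega)
  exact ⟨s, by omega, by omega⟩

theorem rowLen_eq_zero_of_drop (h : IsGorensteinDiagram d k P) (hk : 2 ≤ k) (hd : 1 ≤ d)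
    (hdrop : P.rowLen (d - 1 + 1) < P.rowLen (d - 1)) : P.rowLen d = 0 := by
  by_contra hne
  obtain ⟨s, hs, hl⟩ := h.exists_rowLen_eq hk (by omega)
  have := h.le_of_drop hdrop (s := s) (by omega)
  omega

/-- The partner of such a row would be a row with index below `d` ending in degree `d - 2`, contrary
to diagonal `d - 1` being full. -/
theorem rowLen_eq_zero (h : IsGorensteinDiagram d k P) (hk : 1 ≤ k) (hd : 2 ≤ d) :
    P.rowLen (d + k - 1) = 0 := by
  by_contra hne
  have h2 := h.rowLen_add_le (s := d + k - 1) (by omega)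
  obtain ⟨v, hv⟩ := Nat.exists_eq_add_of_le h2
  have h3 := h.involution (u := d + k - 1) (v := v) (by omega) (by omega)
  have h4 := h.le_rowLen_add hk (s := v) (by omega)
  omega

/-- The row ending in degree `d - 1` has partner `d + k - 2`, which is therefore nonempty. By
`le_of_drop`, that same row excludes drops from `d - 1` up to that partner. -/
theorem not_drop (h : IsGorensteinDiagram d k P) (hk : 2 ≤ k) (hd : 2 ≤ d)
    (hdrop : ¬ P.rowLen (d - 1 + 1) < P.rowLen (d - 1)) :
    0 < P.rowLen (d + k - 2) ∧
      ∀ i, d - 1 ≤ i → i < d + k - 2 → ¬ P.rowLen (i + 1) < P.rowLen i := by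
  have h1 := h.le_rowLen_add (by omega) (s := d - 1) (by omega)
  rw [Nat.sub_add_cancel (by omega)] at hdrop
  obtain ⟨s, hs, hl⟩ := h.exists_rowLen_eq hk (by omega)
  refine ⟨(h.involution (u := s) (v := d + k - 2) (by omega) (by omega)).1, fun i h2 h3 h4 => ?_⟩
  have := h.le_of_drop h4 (s := s) (by omega)
  omega

theorem le_numActive (d k : ℕ) : d - 1 ≤ numActive d k ∧ numActive d k ≤ d := by
  rw [numActive]; split_ifs <;> omega

/-- Past the active range there is no freedom: either the diagram stops after row `d - 1` because of
an active drop there, or its last row is `d + k - 2`. -/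
theorem drop_iff_of_numActive_le (h : IsGorensteinDiagram d k P) (hk : 1 ≤ k) (hd : 2 ≤ d)
    {i : ℕ} (hi : numActive d k ≤ i) :
    P.rowLen (i + 1) < P.rowLen i ↔
      i = d + k - 2 ∧ ¬ (2 ≤ k ∧ P.rowLen (d - 1 + 1) < P.rowLen (d - 1)) := by
  have h0 := h.rowLen_eq_zero hk hd
  have hanti := fun a b => P.rowLen_anti a b
  by_cases hk2 : 2 ≤ k
  · rw [numActive, if_pos hk2] at hi
    by_cases hdrop : P.rowLen (d - 1 + 1) < P.rowLen (d - 1)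
    · have h1 := h.rowLen_eq_zero_of_drop hk2 (by omega) hdrop
      have h2 := hanti d i hi
      constructor
      · intro; omega
      · rintro ⟨-, h3⟩; exact absurd ⟨hk2, hdrop⟩ h3
    · obtain ⟨h1, h2⟩ := h.not_drop hk2 hd hdrop
      constructor
      · intro h3
        refine ⟨?_, fun h4 => hdrop h4.2⟩
        by_contra hne
        rcases lt_or_gt_of_ne hne with h4 | h4
        · exact h2 i (by omega) h4 h3
        · have := hanti (d + k - 1) i (by omega)
          omega
      · rintro ⟨rfl, -⟩
        rw [show d + k - 2 + 1 = d + k - 1 by omega]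
        omega
  · have hk1 : k = 1 := by omega
    subst hk1
    rw [numActive, if_neg hk2] at hi
    have h1 := h.le_rowLen_add (by omega) (s := d - 1) (by omega)
    rw [show d + 1 - 1 = d by omega] at h0
    constructor
    · intro h3
      refine ⟨?_, fun h4 => hk2 h4.1⟩
      by_contra hne
      have := hanti d i (by omega)
      omega
    · rintro ⟨rfl, -⟩
      rw [show d + 1 - 2 + 1 = d by omega, show d + 1 - 2 = d - 1 by omega]
      omega

/-- The diagram is determined by the ends of its blocks of rows among the active degrees. -/
theorem ext_of_drop_iff {P' : YoungDiagram} (h : IsGorensteinDiagram d k P)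
    (h' : IsGorensteinDiagram d k P') (hk : 1 ≤ k) (hd : 2 ≤ d)
    (hdrop : ∀ i < numActive d k,
      P.rowLen (i + 1) < P.rowLen i ↔ P'.rowLen (i + 1) < P'.rowLen i) : P = P' := by
  have hdrop' : ∀ i, P.rowLen (i + 1) < P.rowLen i ↔ P'.rowLen (i + 1) < P'.rowLen i := by
    intro i
    by_cases hi : i < numActive d k
    · exact hdrop i hi
    · rw [h.drop_iff_of_numActive_le hk hd (not_lt.1 hi),
        h'.drop_iff_of_numActive_le hk hd (not_lt.1 hi)]
      refine and_congr_right fun _ => not_congr (and_congr_right fun hk2 => hdrop _ ?_)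
      rw [numActive, if_pos hk2]
      omega
  have hpos : ∀ Q Q' : YoungDiagram,
      (∀ i, Q.rowLen (i + 1) < Q.rowLen i ↔ Q'.rowLen (i + 1) < Q'.rowLen i) →
        ∀ s, 0 < Q.rowLen s → 0 < Q'.rowLen s := by
    intro Q Q' hQ s hs
    obtain ⟨b, hb, hb'⟩ := exists_drop_of_rowLen_pos hs
    have h1 := (hQ b).1 hb'
    have h2 := Q'.rowLen_anti s b hb
    omega
  have key : ∀ s, P.rowLen s = P'.rowLen s := by
    intro s
    induction s using Nat.strong_induction_on with
    | _ s ih =>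
    by_cases hs : 0 < P.rowLen s
    -- A row that starts a block has its length fixed by the first and last rows of the block,
    -- common to both diagrams; any other row repeats the previous one.
    · by_cases ha : s = 0 ∨ P.rowLen s < P.rowLen (s - 1)
      · have ha' : s = 0 ∨ P'.rowLen s < P'.rowLen (s - 1) := by
          rcases Nat.eq_zero_or_pos s with h0 | h0
          · exact Or.inl h0
          · right
            have h1 := (hdrop' (s - 1))
            rw [Nat.sub_add_cancel h0] at h1
            exact h1.1 (ha.resolve_left (by omega))
        have hex := exists_drop_of_rowLen_pos hs
        obtain ⟨hb1, hb2⟩ := Nat.find_spec hex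
        have hmin : ∀ i, s ≤ i → i < Nat.find hex → ¬ P.rowLen (i + 1) < P.rowLen i :=
          fun i h1 h2 h3 => Nat.find_min hex h2 ⟨h1, h3⟩
        have e1 := h.rowLen_add_add_eq ha hb1 (rowLen_eq_of_forall_not_drop hb1 hmin) hb2
        have e2 := h'.rowLen_add_add_eq ha' hb1 (rowLen_eq_of_forall_not_drop hb1
          fun i h1 h2 h3 => hmin i h1 h2 ((hdrop' i).2 h3)) ((hdrop' _).1 hb2)
        omega
      · push Not at ha
        obtain ⟨h0, h1⟩ := ha
        have h2 := hdrop' (s - 1)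
        rw [Nat.sub_add_cancel (by omega)] at h2
        have h3 := ih (s - 1) (by omega)
        have h4 := P.rowLen_anti (s - 1) s (by omega)
        have h5 := P'.rowLen_anti (s - 1) s (by omega)
        omega
    · have := hpos P' P (fun i => (hdrop' i).symm) s
      omega
  ext ⟨s, a⟩
  rw [YoungDiagram.mem_cells, YoungDiagram.mem_cells, YoungDiagram.mem_iff_lt_rowLen,
    YoungDiagram.mem_iff_lt_rowLen, key]

end IsGorensteinDiagram

theorem map_range_add_of_const (l : ℕ → ℕ) (a b v : ℕ) (h : ∀ t < b, l (a + t) = v) :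
    (List.range (a + b)).map l = (List.range a).map l ++ List.replicate b v := by
  rw [List.range_add, List.map_append, List.append_cancel_left_eq, List.map_map,
    List.eq_replicate_iff]
  refine ⟨by simp, fun x hx => ?_⟩
  simp only [List.mem_map, List.mem_range, Function.comp_apply] at hx
  obtain ⟨t, ht, rfl⟩ := hx
  exact h t ht

theorem flatten_ofFn_replicate {n : ℕ} (c : Composition n) (l : ℕ → ℕ) (v : Fin c.length → ℕ)
    (h : ∀ (i : Fin c.length), ∀ t < c.blocksFun i, l (c.sizeUpTo i + t) = v i) :
    (List.ofFn fun i : Fin c.length => List.replicate (c.blocksFun i) (v i)).flatten =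
      (List.range n).map l := by
  have key : ∀ r ≤ c.length,
      ((List.ofFn fun i : Fin c.length => List.replicate (c.blocksFun i) (v i)).take r).flatten =
        (List.range (c.sizeUpTo r)).map l := by
    intro r
    induction r with
    | zero => simp
    | succ r ih =>
      intro hr
      rw [List.take_add_one, List.flatten_append, ih (by omega),
        c.sizeUpTo_succ' ⟨r, hr⟩, map_range_add_of_const l _ _ (v ⟨r, hr⟩) (h ⟨r, hr⟩)]
      congr 1
      rw [List.getElem?_ofFn, dif_pos (show r < c.length by omega)]
      simp
  have h1 := key c.length le_rfl
  rw [List.take_of_length_le (by simp), c.sizeUpTo_length] at h1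
  exact h1

/-- The row lengths of the diagram whose blocks end, among the active degrees, at the partial
sums of a composition. -/
theorem IsGorensteinDiagram.rowLens_eq_explicitParts {d k : ℕ} {P : YoungDiagram}
    (h : IsGorensteinDiagram d k P) (hk : 1 ≤ k) (hd : 2 ≤ d) {n : ℕ} (c : Composition n)
    (hn : n ≤ numActive d k)
    (hdrop : ∀ m < numActive d k, P.rowLen (m + 1) < P.rowLen m ↔
      ∃ i : Fin c.length, m = c.sizeUpTo (i + 1) - 1) :
    P.rowLens = explicitParts d k c := by
  have hN := IsGorensteinDiagram.le_numActive d k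
  have hstart : ∀ r ≤ c.length, c.sizeUpTo r = 0 ∨
      P.rowLen (c.sizeUpTo r) < P.rowLen (c.sizeUpTo r - 1) := by
    intro r hr
    rcases Nat.eq_zero_or_pos (c.sizeUpTo r) with h0 | h0
    · exact Or.inl h0
    · right
      have hr0 : r ≠ 0 := by rintro rfl; simp at h0
      have h1 := c.sizeUpTo_le r
      have h2 := (hdrop (c.sizeUpTo r - 1) (by omega)).2 ⟨⟨r - 1, by omega⟩, by
        simp only [Nat.sub_add_cancel (show 1 ≤ r by omega)]⟩
      rwa [Nat.sub_add_cancel h0] at h2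
  have hblock : ∀ (i : Fin c.length), ∀ t < c.blocksFun i, P.rowLen (c.sizeUpTo i + t) =
      k - 1 + 2 * d - c.blocksFun i - 2 * c.sizeUpTo i := by
    intro i t ht
    have hs := c.sizeUpTo_succ' i
    have hle := c.sizeUpTo_le (i + 1)
    -- No partial sum lies strictly between consecutive ones, so the rows from `c.sizeUpTo i` to
    -- `c.sizeUpTo (i + 1) - 1` form one block.
    have hnd : ∀ m, c.sizeUpTo i ≤ m → m < c.sizeUpTo (i + 1) - 1 →
        ¬ P.rowLen (m + 1) < P.rowLen m := by
      intro m h1 h2 h3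
      obtain ⟨i', hi'⟩ := (hdrop m (by omega)).1 h3
      have h4 := c.one_le_blocksFun i'
      have hs' := c.sizeUpTo_succ' i'
      rcases lt_or_ge (i' : ℕ) i with h5 | h5
      · have := c.monotone_sizeUpTo (show (i' : ℕ) + 1 ≤ i by omega)
        omega
      · have := c.monotone_sizeUpTo (show (i : ℕ) + 1 ≤ i' + 1 by omega)
        omega
    have hb := (hdrop (c.sizeUpTo (i + 1) - 1) (by omega)).2 ⟨i, rfl⟩
    have e1 := rowLen_eq_of_forall_not_drop (P := P) (a := c.sizeUpTo i)
      (b := c.sizeUpTo (i + 1) - 1) (by omega) hnd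
    have e2 := h.rowLen_add_add_eq (hstart i i.2.le) (by omega) e1 hb
    have e3 := rowLen_eq_of_forall_not_drop (P := P) (a := c.sizeUpTo i)
      (b := c.sizeUpTo i + t) (by omega) fun m h1 h2 => hnd m h1 (by omega)
    omega
  have hflat := flatten_ofFn_replicate c P.rowLen _ hblock
  have hnd : ∀ m, n ≤ m → m < numActive d k → ¬ P.rowLen (m + 1) < P.rowLen m := by
    intro m h1 h2 h3
    obtain ⟨i, hi⟩ := (hdrop m h2).1 h3
    have := c.sizeUpTo_le (i + 1)
    have := c.one_le_blocksFun i
    have := c.sizeUpTo_succ' i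
    omega
  have hstart' := hstart c.length le_rfl
  rw [c.sizeUpTo_length] at hstart'
  have hcol : ∀ m, 0 < P.rowLen (m - 1) → 0 < m → P.rowLen m = 0 → P.colLen 0 = m := by
    intro m h1 h2 h3
    have h4 := (YoungDiagram.mem_iff_lt_rowLen (μ := P) (i := m - 1) (j := 0)).2 h1
    have h5 := mt (YoungDiagram.mem_iff_lt_rowLen (μ := P) (i := m) (j := 0)).1 (by omega)
    rw [YoungDiagram.mem_iff_lt_colLen] at h4 h5
    omega
  rw [explicitParts, hflat]
  change (List.range (P.colLen 0)).map P.rowLen = _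
  split_ifs with hnd'
  -- The remaining rows `n, …, d + k - 2` form one block, whose length is `(2d+k-2) - n - (d+k-2) =
  -- d - n`.
  · have h1 : P.rowLen (d + k - 2 + 1) < P.rowLen (d + k - 2) := by
      refine (h.drop_iff_of_numActive_le hk hd (by rw [numActive]; split_ifs <;> omega)).2
        ⟨rfl, fun h2 => ?_⟩
      exact hnd (d - 1) (by omega) (by rw [numActive, if_pos h2.1]; omega) h2.2
    have h2 : ∀ m, n ≤ m → m < d + k - 2 → ¬ P.rowLen (m + 1) < P.rowLen m := by
      intro m h3 h4 h5
      by_cases h6 : m < numActive d k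
      · exact hnd m h3 h6 h5
      · have := (h.drop_iff_of_numActive_le hk hd (not_lt.1 h6)).1 h5
        omega
    have e1 := h.rowLen_add_add_eq hstart' (show n ≤ d + k - 2 by omega)
      (rowLen_eq_of_forall_not_drop (by omega) h2) h1
    have h0 := h.rowLen_eq_zero hk hd
    rw [hcol (d + k - 1) (by rw [show d + k - 1 - 1 = d + k - 2 by omega]; omega) (by omega) h0,
      show d + k - 1 = n + (d - n + k - 1) by omega]
    refine map_range_add_of_const _ _ _ _ fun t ht => ?_
    rw [rowLen_eq_of_forall_not_drop (a := n) (by omega) fun m h3 h4 => h2 m h3 (by omega)]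
    omega
  · have hn' : n = d := by omega
    subst hn'
    have hk2 : 2 ≤ k := by
      by_contra hk2
      rw [numActive, if_neg hk2] at hn
      omega
    have h1 := hstart'.resolve_left (by omega)
    have h2 := h.rowLen_eq_zero_of_drop hk2 (by omega) (by rwa [Nat.sub_add_cancel (by omega)])
    rw [hcol n (by omega) (by omega) h2, List.append_nil]

end Diagrams

/-! ### Gorenstein symmetry and Hessians through the differentiation action. -/

section Duality

variable {K : Type*} [Field K]

theorem coeff_pderiv_pow (i : Fin 2) (n : ℕ) (G : MvPolynomial (Fin 2) K) (e : Fin 2 →₀ ℕ) :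
    coeff e ((((pderiv i).toLinearMap : Module.End K (MvPolynomial (Fin 2) K)) ^ n) G) =
      coeff (e + Finsupp.single i n) G * ((e i + n).descFactorial n : K) := by
  induction n generalizing e with
  | zero => simp
  | succ n ih =>
    rw [pow_succ', Module.End.mul_apply]
    change coeff e (pderiv i _) = _
    rw [coeff_pderiv, ih, add_assoc, ← Finsupp.single_add, add_comm 1 n, Finsupp.add_apply,
      Finsupp.single_eq_same, mul_assoc]
    congr 1
    rw [show e i + (n + 1) = e i + 1 + n by ring, Nat.descFactorial_succ,
      show e i + 1 + n - n = e i + 1 by omega]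
    push_cast
    ring

theorem coeff_diffOp_monomial (m : Fin 2 →₀ ℕ) (G : MvPolynomial (Fin 2) K) (e : Fin 2 →₀ ℕ) :
    coeff e (diffOp (monomial m 1) G) =
      coeff (e + m) G * ((e 0 + m 0).descFactorial (m 0) * (e 1 + m 1).descFactorial (m 1) : K) := by
  rw [diffOp_monomial_one, Module.End.mul_apply, coeff_pderiv_pow, coeff_pderiv_pow]
  have : e + Finsupp.single 0 (m 0) + Finsupp.single 1 (m 1) = e + m := by
    ext i; fin_cases i <;> simp
  rw [this]
  simp
  ring

theorem diffOp_eq_sum (f G : MvPolynomial (Fin 2) K) :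
    diffOp f G = ∑ m ∈ f.support, coeff m f • diffOp (monomial m 1) G := by
  conv_lhs => rw [f.as_sum]
  rw [map_sum, LinearMap.sum_apply]
  refine Finset.sum_congr rfl fun m _ => ?_
  rw [show monomial m (coeff m f) = coeff m f • monomial m (1 : K) by
    rw [smul_monomial, smul_eq_mul, mul_one], map_smul, LinearMap.smul_apply]

theorem coeff_diffOp_eq_zero {f G : MvPolynomial (Fin 2) K} {a n : ℕ} (hf : f.IsHomogeneous a)
    (hG : G.IsHomogeneous n) {e : Fin 2 →₀ ℕ} (he : e.degree + a ≠ n) :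
    coeff e (diffOp f G) = 0 := by
  rw [diffOp_eq_sum, coeff_sum]
  refine Finset.sum_eq_zero fun m hm => ?_
  rw [coeff_smul, coeff_diffOp_monomial, hG.coeff_eq_zero, zero_mul, smul_zero]
  rw [map_add, show m.degree = a from by
    by_contra hne
    exact (mem_support_iff.1 hm) (hf.coeff_eq_zero hne)]
  exact he

theorem isHomogeneous_diffOp {f G : MvPolynomial (Fin 2) K} {a b : ℕ} (hf : f.IsHomogeneous a)
    (hG : G.IsHomogeneous (a + b)) : (diffOp f G).IsHomogeneous b := by
  intro e he
  have h1 : Finsupp.weight 1 e = e.degree := by rw [Finsupp.degree_eq_weight_one]; rfl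
  rw [h1]
  by_contra hne
  exact he (coeff_diffOp_eq_zero hf hG (by omega))

theorem diffOp_eq_zero_of_lt {f G : MvPolynomial (Fin 2) K} {a n : ℕ} (hf : f.IsHomogeneous a)
    (hG : G.IsHomogeneous n) (h : n < a) : diffOp f G = 0 := by
  ext e
  rw [coeff_diffOp_eq_zero hf hG (by omega), coeff_zero]

theorem diffOp_comm (f g G : MvPolynomial (Fin 2) K) :
    diffOp f (diffOp g G) = diffOp g (diffOp f G) := by
  rw [← Module.End.mul_apply, ← Module.End.mul_apply, ← diffOp_mul, ← diffOp_mul, mul_comm]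

/-- A monomial operator of degree `n` extracts the matching coefficient times a product of
factorials, invertible in characteristic zero. -/
theorem eq_zero_of_forall_coeff_diffOp [CharZero K] {G : MvPolynomial (Fin 2) K} {n : ℕ}
    (hG : G.IsHomogeneous n)
    (h : ∀ f : MvPolynomial (Fin 2) K, f.IsHomogeneous n → coeff 0 (diffOp f G) = 0) : G = 0 := by
  ext m
  rw [coeff_zero]
  by_cases hm : m.degree = n
  · have := h (monomial m 1) (isHomogeneous_monomial _ hm)
    rw [coeff_diffOp_monomial] at this
    simp only [Finsupp.coe_zero, Pi.zero_apply, zero_add, Nat.descFactorial_self] at this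
    refine (mul_eq_zero.1 this).resolve_right ?_
    exact mul_ne_zero (Nat.cast_ne_zero.2 (Nat.factorial_ne_zero _))
      (Nat.cast_ne_zero.2 (Nat.factorial_ne_zero _))
  · exact hG.coeff_eq_zero hm

/-- As `F` is a form, the components of `f` send it to forms of different degrees, which cannot
cancel. -/
theorem homogeneousComponent_mem_annIdeal {F : MvPolynomial (Fin 2) K} {j : ℕ}
    (hF : F.IsHomogeneous j) (n : ℕ) (f : MvPolynomial (Fin 2) K) (hf : f ∈ annIdeal F) :
    homogeneousComponent n f ∈ annIdeal F := by
  change diffOp f F = 0 at hf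
  change diffOp (homogeneousComponent n f) F = 0
  ext e
  rw [coeff_zero]
  by_cases he : e.degree + n = j
  · rw [← sum_homogeneousComponent f, map_sum, LinearMap.sum_apply] at hf
    have h1 := congrArg (coeff e) hf
    rw [coeff_sum, coeff_zero] at h1
    rw [← h1]
    symm
    apply Finset.sum_eq_single n
    · intro i _ hi
      exact coeff_diffOp_eq_zero (homogeneousComponent_isHomogeneous i f) hF (by omega)
    · intro hn
      rw [homogeneousComponent_eq_zero _ _ (by simp at hn; omega), map_zero]
      simp
  · exact coeff_diffOp_eq_zero (homogeneousComponent_isHomogeneous n f) hF he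

theorem diffOp_one (G : MvPolynomial (Fin 2) K) : diffOp 1 G = G := by
  rw [show (1 : MvPolynomial (Fin 2) K) = monomial 0 1 from rfl, diffOp_monomial_one]
  simp

theorem diffOp_linearForm (p : Fin 2 → K) (G : MvPolynomial (Fin 2) K) :
    diffOp (linearForm p) G = C (p 0) * pderiv 0 G + C (p 1) * pderiv 1 G := by
  rw [linearForm, ← smul_eq_C_mul, ← smul_eq_C_mul, map_add, map_smul, map_smul]
  have h0 : (X 0 : MvPolynomial (Fin 2) K) = monomial (Finsupp.single 0 1) 1 := rfl
  have h1 : (X 1 : MvPolynomial (Fin 2) K) = monomial (Finsupp.single 1 1) 1 := rfl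
  rw [h0, h1, diffOp_monomial_one, diffOp_monomial_one]
  simp [smul_eq_C_mul]

/-- Applying `(p₀ ∂_X + p₁ ∂_Y) ^ n` to a form of degree `n` evaluates it at `p`, up to `n!`. -/
theorem coeff_diffOp_linearForm_pow {G : MvPolynomial (Fin 2) K} {n : ℕ} (p : Fin 2 → K)
    (hG : G.IsHomogeneous n) :
    coeff 0 (diffOp (linearForm p ^ n) G) = n.factorial * eval p G := by
  induction n generalizing G with
  | zero =>
    rw [← totalDegree_zero_iff_isHomogeneous, totalDegree_eq_zero_iff_eq_C] at hG
    rw [hG, pow_zero, diffOp_one]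
    simp
  | succ n ih =>
    rw [pow_succ, diffOp_mul, Module.End.mul_apply, ih, diffOp_linearForm]
    · have h := congrArg (eval p) hG.sum_X_mul_pderiv
      rw [Fin.sum_univ_two] at h
      simp only [map_add, map_mul, eval_X, eval_C, nsmul_eq_mul, map_natCast] at h ⊢
      rw [h, Nat.factorial_succ]
      push_cast
      ring
    · exact isHomogeneous_diffOp (isHomogeneous_linearForm p) (by rwa [add_comm])

theorem finrank_range_flip {V W : Type*} [AddCommGroup V] [Module K V] [AddCommGroup W]
    [Module K W] [FiniteDimensional K V] [FiniteDimensional K W] (B : V →ₗ[K] W →ₗ[K] K) :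
    Module.finrank K (LinearMap.range B.flip) = Module.finrank K (LinearMap.range B) := by
  have h : B.flip = B.dualMap ∘ₗ (Module.evalEquiv K W).toLinearMap := by
    ext w v
    simp
  rw [h, LinearMap.range_comp_of_range_eq_top _ (LinearEquiv.range _)]
  exact LinearMap.finrank_range_dualMap_eq_finrank_range B

/-- The bilinear form `(f, g) ↦ (ℓ ^ a * f * g) ∘ F` on forms of degrees `i` and `i'`. -/
def macaulayForm (F : MvPolynomial (Fin 2) K) (p : Fin 2 → K) (a i i' : ℕ) :
    homogeneousSubmodule (Fin 2) K i →ₗ[K] homogeneousSubmodule (Fin 2) K i' →ₗ[K] K :=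
  LinearMap.mk₂ K (fun f g => coeff 0 (diffOp (linearForm p ^ a *
      ((f : MvPolynomial (Fin 2) K) * (g : MvPolynomial (Fin 2) K))) F))
    (by intros; simp [add_mul, mul_add])
    (by intros; rw [Submodule.coe_smul, smul_mul_assoc, mul_smul_comm, map_smul,
      LinearMap.smul_apply, coeff_smul])
    (by intros; simp [mul_add])
    (by intros; rw [Submodule.coe_smul, mul_smul_comm, mul_smul_comm, map_smul,
      LinearMap.smul_apply, coeff_smul])

theorem mem_annIdeal_iff [CharZero K] {F f : MvPolynomial (Fin 2) K} {a b : ℕ}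
    (hF : F.IsHomogeneous (a + b)) (hf : f.IsHomogeneous a) :
    f ∈ annIdeal F ↔ ∀ g : MvPolynomial (Fin 2) K, g.IsHomogeneous b →
      coeff 0 (diffOp (f * g) F) = 0 := by
  constructor
  · intro h g _
    have h' : diffOp f F = 0 := h
    rw [diffOp_mul, Module.End.mul_apply, diffOp_comm, h', map_zero, coeff_zero]
  · intro h
    refine eq_zero_of_forall_coeff_diffOp (isHomogeneous_diffOp hf hF) fun g hg => ?_
    rw [diffOp_comm, ← Module.End.mul_apply, ← diffOp_mul]
    exact h g hg

/-- The left kernel of the pairing consists of the `f` with `ℓ^a f ∈ Ann F`, by nondegeneracy of the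
differentiation pairing in degree `i'`. -/
theorem finrank_range_macaulayForm [CharZero K] {F : MvPolynomial (Fin 2) K} (p : Fin 2 → K)
    {a i i' : ℕ} (hF : F.IsHomogeneous (a + i + i')) :
    Module.finrank K (LinearMap.range (macaulayForm F p a i i')) =
      Module.finrank K ((gradedPiece (annIdeal F) i).map (mulLinear (annIdeal F) p ^ a)) := by
  set L : homogeneousSubmodule (Fin 2) K i →ₗ[K] MvPolynomial (Fin 2) K ⧸ annIdeal F :=
    (mulLinear (annIdeal F) p ^ a) ∘ₗ (Ideal.Quotient.mkₐ K (annIdeal F)).toLinearMap ∘ₗ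
      (homogeneousSubmodule (Fin 2) K i).subtype with hL
  have hLf : ∀ f, L f = Ideal.Quotient.mk (annIdeal F) (linearForm p ^ a * f) := fun f =>
    mulLinear_pow_mk _ _ _ _
  have hrange : (gradedPiece (annIdeal F) i).map (mulLinear (annIdeal F) p ^ a) =
      LinearMap.range L := by
    rw [hL, LinearMap.range_comp, LinearMap.range_comp, Submodule.range_subtype, gradedPiece]
  have hker : LinearMap.ker (macaulayForm F p a i i') = LinearMap.ker L := by
    ext f
    rw [LinearMap.mem_ker, LinearMap.mem_ker, hLf, Ideal.Quotient.eq_zero_iff_mem,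
      mem_annIdeal_iff hF ((isHomogeneous_linearForm_pow p a).mul f.2)]
    simp only [mul_assoc]
    constructor
    · intro h g hg
      exact congrArg (fun φ => φ ⟨g, hg⟩) h
    · intro h
      ext g
      exact h g g.2
  have h1 := LinearMap.finrank_range_add_finrank_ker (macaulayForm F p a i i')
  have h2 := LinearMap.finrank_range_add_finrank_ker L
  rw [hrange]
  rw [hker] at h1
  omega

/-- Multiplication by `ℓ ^ a` from degree `i` and from the complementary degree `i'` have the same
rank, by Gorenstein duality. -/
theorem finrank_map_mulLinear_pow_symm [CharZero K] {F : MvPolynomial (Fin 2) K} (p : Fin 2 → K)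
    {a i i' : ℕ} (hF : F.IsHomogeneous (a + i + i')) :
    Module.finrank K ((gradedPiece (annIdeal F) i).map (mulLinear (annIdeal F) p ^ a)) =
      Module.finrank K ((gradedPiece (annIdeal F) i').map (mulLinear (annIdeal F) p ^ a)) := by
  rw [← finrank_range_macaulayForm p hF,
    ← finrank_range_macaulayForm p (show F.IsHomogeneous (a + i' + i) by
      rwa [add_right_comm]), ← finrank_range_flip]
  have h : (macaulayForm F p a i i').flip = macaulayForm F p a i' i := by
    ext g f
    simp only [macaulayForm, LinearMap.flip_apply, LinearMap.mk₂_apply, mul_comm]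
  rw [h]

theorem seqT_eq_zero {d k i : ℕ} (h : 2 * d + k - 3 < i) : seqT d k i = 0 := by
  rw [seqT]; omega

open Classical in
theorem card_filter_mem {I : Ideal (MvPolynomial (Fin 2) K)} {p : Fin 2 → K} {P : YoungDiagram}
    (hP : ∀ s a, (s, a) ∈ P ↔ ¬ Reduces I p s a) (t : Finset ℕ) (e : ℕ → ℕ) :
    (t.filter fun s => (s, e s) ∈ P).card = (t.filter fun s => ¬ Reduces I p s (e s)).card :=
  congrArg _ (Finset.filter_congr fun s _ => hP s _)

/-- The diagram of an admissible form has the Gorenstein symmetry. -/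
theorem IsCIDualGenerator.isGorensteinDiagram [CharZero K] {d k : ℕ} {F : MvPolynomial (Fin 2) K}
    (hF : IsCIDualGenerator d k F) {p : Fin 2 → K} (hp : p ≠ 0) {P : YoungDiagram}
    (hP : ∀ s a, (s, a) ∈ P ↔ ¬ Reduces (annIdeal F) p s a) : IsGorensteinDiagram d k P where
  add_le s a h := by
    by_contra hlt
    refine (hP s a).1 h (reduces_of_hilbertFunction_eq_zero hp ?_)
    rw [hF.hilbertFunction_eq, seqT_eq_zero (by omega)]
  symm u v huv := by
    obtain ⟨a, ha⟩ := Nat.exists_eq_add_of_le huv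
    have h := finrank_map_mulLinear_pow_symm p (F := F) (a := a) (i := u) (i' := v)
      (by have := hF.isHomogeneous; rw [ha] at this; convert this using 1; ring)
    rw [finrank_map_mulLinear_pow _ hp, finrank_map_mulLinear_pow _ hp] at h
    have e1 : 2 * d + k - 3 - v = u + a := by omega
    have e2 : 2 * d + k - 3 - u = v + a := by omega
    rw [e1, e2, card_filter_mem hP, card_filter_mem hP]
    exact h
  card_eq i := by
    have h := hilbertFunction_eq_card (annIdeal F) hp i
    rw [hF.hilbertFunction_eq] at h
    rw [card_filter_mem hP, h]

/-- Up to the factor `a!`, evaluating `(f g) ∘ F` at `p` is applying `ℓ^a` to it. So the Hessian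
matrix at `p` represents the pairing `(ℓ^a f g) ∘ F` on `A_i`, whose kernel is that of `ℓ^a`. -/
theorem hessianAt_ne_zero_iff [CharZero K] {F : MvPolynomial (Fin 2) K} {i a : ℕ}
    (hF : F.IsHomogeneous (a + i + i)) (p : Fin 2 → K) :
    hessianAt F i p ≠ 0 ↔
      ∀ u ∈ gradedPiece (annIdeal F) i, (mulLinear (annIdeal F) p ^ a) u = 0 → u = 0 := by
  let B : LinearMap.BilinForm K (gradedPiece (annIdeal F) i) :=
    LinearMap.mk₂ K (fun s t => eval p (act F ((s : MvPolynomial (Fin 2) K ⧸ annIdeal F) * t)))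
      (by intros; simp [add_mul])
      (by intros; rw [Submodule.coe_smul, smul_mul_assoc, map_smul, smul_eval, smul_eq_mul])
      (by intros; simp [mul_add])
      (by intros; rw [Submodule.coe_smul, mul_smul_comm, map_smul, smul_eval, smul_eq_mul])
  have h1 : hessianAt F i p =
      (LinearMap.BilinForm.toMatrix (Module.finBasis K (gradedPiece (annIdeal F) i)) B).det := by
    rw [hessianAt, hessian, RingHom.map_det]
    congr 1
    ext u v
    simp [B, hessianMatrix]
  rw [h1, ← LinearMap.BilinForm.nondegenerate_iff_det_ne_zero,
    LinearMap.BilinForm.nondegenerate_iff_ker_eq_bot, LinearMap.ker_eq_bot']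
  have key : ∀ f : MvPolynomial (Fin 2) K, ∀ hf : f.IsHomogeneous i,
      B ⟨Ideal.Quotient.mk _ f, f, hf, rfl⟩ = 0 ↔
        (mulLinear (annIdeal F) p ^ a) (Ideal.Quotient.mk _ f) = 0 := by
    intro f hf
    rw [mulLinear_pow_mk, Ideal.Quotient.eq_zero_iff_mem,
      mem_annIdeal_iff hF ((isHomogeneous_linearForm_pow p a).mul hf)]
    have hval : ∀ g : MvPolynomial (Fin 2) K, ∀ hg : g.IsHomogeneous i,
        coeff 0 (diffOp (linearForm p ^ a * f * g) F) = a.factorial *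
          B ⟨Ideal.Quotient.mk _ f, f, hf, rfl⟩ ⟨Ideal.Quotient.mk _ g, g, hg, rfl⟩ := by
      intro g hg
      rw [mul_assoc, diffOp_mul, Module.End.mul_apply, coeff_diffOp_linearForm_pow p
        (isHomogeneous_diffOp (hf.mul hg) (by convert hF using 1; ring))]
      rfl
    constructor
    · intro h g hg
      rw [hval g hg, h, LinearMap.zero_apply, mul_zero]
    · intro h
      ext ⟨_, g, hg, rfl⟩
      have h2 := h g hg
      rw [hval g hg] at h2
      exact (mul_eq_zero.1 h2).resolve_left (Nat.cast_ne_zero.2 (Nat.factorial_ne_zero _))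
  constructor
  · rintro h _ ⟨f, hf, rfl⟩ h0
    exact congrArg Subtype.val (h _ ((key f hf).2 h0))
  · rintro h ⟨_, f, hf, rfl⟩ h0
    exact Subtype.ext (h _ ⟨f, hf, rfl⟩ ((key f hf).1 h0))

theorem hessianAt_ne_zero_iff_forall_mem [CharZero K] {d k : ℕ} (hk : 1 ≤ k)
    {F : MvPolynomial (Fin 2) K}
    (hF : IsCIDualGenerator d k F) {p : Fin 2 → K} (hp : p ≠ 0) {P : YoungDiagram}
    (hP : ∀ s a, (s, a) ∈ P ↔ ¬ Reduces (annIdeal F) p s a) {i : ℕ} (hi : 2 * i ≤ 2 * d + k - 3)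
    (hid : i < d) :
    hessianAt F i p ≠ 0 ↔ ∀ s ≤ i, (s, 2 * d + k - 3 - i - s) ∈ P := by
  obtain ⟨a, ha⟩ := Nat.exists_eq_add_of_le hi
  rw [hessianAt_ne_zero_iff (a := a)
    (by have := hF.isHomogeneous; rw [ha] at this; convert this using 1; ring)]
  have hrank := finrank_map_mulLinear_pow (annIdeal F) hp i a
  have hhilb := hF.hilbertFunction_eq i
  -- Since `dim A_i = i + 1`, injectivity of `ℓ^a` means that all of the rows `0, …, i` meet
  -- diagonal `i + a`.
  rw [show seqT d k i = (Finset.range (i + 1)).card by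
    rw [Finset.card_range, seqT]; omega, hilbertFunction] at hhilb
  set ψ := (mulLinear (annIdeal F) p ^ a).domRestrict (gradedPiece (annIdeal F) i) with hψ
  have hr : LinearMap.range ψ =
      (gradedPiece (annIdeal F) i).map (mulLinear (annIdeal F) p ^ a) :=
    LinearMap.range_domRestrict _ _
  have h1 := LinearMap.finrank_range_add_finrank_ker ψ
  rw [hr, hhilb] at h1
  have h2 : (∀ u ∈ gradedPiece (annIdeal F) i, (mulLinear (annIdeal F) p ^ a) u = 0 → u = 0) ↔
      LinearMap.ker ψ = ⊥ := by
    rw [LinearMap.ker_eq_bot']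
    constructor
    · rintro h ⟨u, hu⟩ h0
      exact Subtype.ext (h u hu h0)
    · intro h u hu h0
      exact congrArg Subtype.val (h ⟨u, hu⟩ h0)
  rw [h2, ← Submodule.finrank_eq_zero]
  have h3 : Module.finrank K (LinearMap.ker ψ) = 0 ↔
      Module.finrank K ((gradedPiece (annIdeal F) i).map (mulLinear (annIdeal F) p ^ a)) =
        (Finset.range (i + 1)).card := by
    omega
  classical
  rw [h3, hrank, Finset.card_filter_eq_iff]
  simp only [Finset.mem_range, Nat.lt_succ_iff, hP]
  rw [show 2 * d + k - 3 - i = i + a by omega]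

end Duality

/-! ### Macaulay duality for complete intersections in two variables. -/

section Macaulay

variable {K : Type*} [Field K]

theorem homogeneousComponent_mem_span_pair {f g : MvPolynomial (Fin 2) K} {a b : ℕ}
    (hf : f.IsHomogeneous a) (hg : g.IsHomogeneous b) (n : ℕ) (h : MvPolynomial (Fin 2) K)
    (hh : h ∈ Ideal.span {f, g}) : homogeneousComponent n h ∈ Ideal.span {f, g} := by
  obtain ⟨α, β, rfl⟩ := Ideal.mem_span_pair.1 hh
  rw [map_add, homogeneousComponent_mul_of_isHomogeneous hf,
    homogeneousComponent_mul_of_isHomogeneous hg]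
  refine Ideal.add_mem _ ?_ ?_
  · split_ifs
    · exact Ideal.mul_mem_left _ _ (Ideal.subset_span (by simp))
    · exact Ideal.zero_mem _
  · split_ifs
    · exact Ideal.mul_mem_left _ _ (Ideal.subset_span (by simp))
    · exact Ideal.zero_mem _

theorem linearForm_one_zero : (linearForm ![1, 0] : MvPolynomial (Fin 2) K) = X 0 := by
  simp [linearForm]

theorem linearForm_zero_one : (linearForm ![0, 1] : MvPolynomial (Fin 2) K) = X 1 := by
  simp [linearForm]

theorem one_zero_ne_zero : (![1, 0] : Fin 2 → K) ≠ 0 := fun h => by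
  simpa using congrFun h 0

theorem eval_perp_one_zero_X_one : eval (perp ![1, 0]) (X 1 : MvPolynomial (Fin 2) K) = 1 := by
  simp [perp]

theorem span_pair_sub_mul {R : Type*} [CommRing R] (f g c : R) :
    Ideal.span {f, g - c * f} = Ideal.span {f, g} := by
  apply le_antisymm <;> rw [Ideal.span_le] <;> rintro z (rfl | rfl)
  · exact Ideal.subset_span (by simp)
  · exact Ideal.sub_mem _ (Ideal.subset_span (by simp))
      (Ideal.mul_mem_left _ _ (Ideal.subset_span (by simp)))
  · exact Ideal.subset_span (by simp)
  · exact Ideal.mem_span_pair.2 ⟨c, 1, by ring⟩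

/-- A pair of forms generating a homogeneous ideal of finite colength may be taken of the shape
`f, x * g` with `f` not divisible by `x`. -/
theorem exists_span_eq_span_pair_X_mul {I : Ideal (MvPolynomial (Fin 2) K)}
    {f g : MvPolynomial (Fin 2) K} {a b : ℕ} (hf : f.IsHomogeneous a) (hg : g.IsHomogeneous b)
    (hI : I = Ideal.span {f, g}) {n : ℕ} (hn : hilbertFunction I n = 0) :
    ∃ (f' g' : MvPolynomial (Fin 2) K) (a' e : ℕ), f'.IsHomogeneous a' ∧ g'.IsHomogeneous e ∧
      eval (perp ![1, 0]) f' ≠ 0 ∧ I = Ideal.span {f', X 0 * g'} := by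
  have aux : ∀ (f g : MvPolynomial (Fin 2) K) (a b : ℕ), f.IsHomogeneous a → g.IsHomogeneous b →
      I = Ideal.span {f, g} → eval (perp ![1, 0]) f ≠ 0 →
      (eval (perp ![1, 0]) g = 0 ∨ a ≤ b) →
      ∃ (f' g' : MvPolynomial (Fin 2) K) (a' e : ℕ), f'.IsHomogeneous a' ∧ g'.IsHomogeneous e ∧
      eval (perp ![1, 0]) f' ≠ 0 ∧ I = Ideal.span {f', X 0 * g'} := by
    intro f g a b hf hg hI h0 h
    by_cases hg0 : eval (perp ![1, 0]) g = 0
    · obtain ⟨g', hg', rfl⟩ := IsHomogeneous.exists_eq_linearForm_mul one_zero_ne_zero hg hg0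
      rw [linearForm_one_zero] at hI
      exact ⟨f, g', a, _, hf, hg', h0, hI⟩
    · have hab := h.resolve_left hg0
      set c : MvPolynomial (Fin 2) K := C (eval (perp ![1, 0]) g / eval (perp ![1, 0]) f) * X 1 ^ (b - a) with hc
      have h1 : (g - c * f).IsHomogeneous b := by
        refine hg.sub ?_
        have := ((isHomogeneous_X_pow (R := K) (1 : Fin 2) (b - a)).C_mul
          (eval (perp ![1, 0]) g / eval (perp ![1, 0]) f)).mul hf
        rwa [Nat.sub_add_cancel hab] at this
      obtain ⟨g', hg', he⟩ := IsHomogeneous.exists_eq_linearForm_mul one_zero_ne_zero h1 (by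
        rw [map_sub, map_mul, hc, map_mul, eval_C, map_pow, eval_perp_one_zero_X_one]
        field_simp
        simp)
      rw [linearForm_one_zero] at he
      exact ⟨f, g', a, _, hf, hg', h0, by rw [← he, span_pair_sub_mul, hI]⟩
  by_cases hf0 : eval (perp ![1, 0]) f = 0
  · by_cases hg0 : eval (perp ![1, 0]) g = 0
    -- A power of `y` lies in `I`, so the two generators cannot both be divisible by `x`.
    · exfalso
      have h1 : (X 1 ^ n : MvPolynomial (Fin 2) K) ∈ I :=
        mem_of_hilbertFunction_eq_zero hn (isHomogeneous_X_pow _ _)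
      rw [hI] at h1
      obtain ⟨α, β, h2⟩ := Ideal.mem_span_pair.1 h1
      have h3 := congrArg (eval (perp ![1, 0])) h2
      rw [map_add, map_mul, map_mul, hf0, hg0, map_pow, eval_perp_one_zero_X_one] at h3
      simp at h3
    · exact aux g f b a hg hf (by rw [hI, Set.pair_comm]) hg0 (Or.inl hf0)
  · by_cases hg0 : eval (perp ![1, 0]) g = 0
    · exact aux f g a b hf hg hI hf0 (Or.inl hg0)
    · rcases le_total a b with hab | hab
      · exact aux f g a b hf hg hI hf0 (Or.inr hab)
      · exact aux g f b a hg hf (by rw [hI, Set.pair_comm]) hg0 (Or.inr hab)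

theorem X_zero_dvd_of_dvd_mul {f h : MvPolynomial (Fin 2) K} (hf : eval (perp ![1, 0]) f ≠ 0)
    (hd : X 0 ∣ h * f) : (X 0 : MvPolynomial (Fin 2) K) ∣ h := by
  refine (X_prime.dvd_or_dvd hd).resolve_right ?_
  rintro ⟨z, rfl⟩
  exact hf (by simp [perp])

/-- The kernel of multiplication by `x` on `K[x,y] / (f, x * g)` is generated, as a `K[y]`-module,
by the class of `g`. -/
theorem exists_sub_mem_of_X_mul_mem {f g h : MvPolynomial (Fin 2) K} {a e i : ℕ}
    (hf : f.IsHomogeneous a) (hg : g.IsHomogeneous e) (hf0 : eval (perp ![1, 0]) f ≠ 0)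
    (hh : h.IsHomogeneous i) (hx : X 0 * h ∈ Ideal.span {f, X 0 * g}) :
    h ∈ Ideal.span {f, X 0 * g} ∨
      e ≤ i ∧ ∃ c : K, c ≠ 0 ∧ h - C c * X 1 ^ (i - e) * g ∈ Ideal.span {f, X 0 * g} := by
  obtain ⟨α, β, h1⟩ := Ideal.mem_span_pair.1 hx
  obtain ⟨α', rfl⟩ := X_zero_dvd_of_dvd_mul (h := α) hf0
    ⟨h - β * g, by linear_combination h1⟩
  have h2 : h = α' * f + β * g := by
    refine mul_left_cancel₀ (X_ne_zero (0 : Fin 2)) ?_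
    linear_combination -h1
  have h3 : ∃ γ : MvPolynomial (Fin 2) K, h - γ * f = homogeneousComponent i (β * g) := by
    have h4 := homogeneousComponent_eq_self hh
    rw [h2, map_add, homogeneousComponent_mul_of_isHomogeneous hf, ← h2] at h4
    split_ifs at h4
    · exact ⟨homogeneousComponent (i - a) α', by linear_combination -h4⟩
    · exact ⟨0, by linear_combination -h4⟩
  obtain ⟨γ, h3⟩ := h3
  rw [homogeneousComponent_mul_of_isHomogeneous hg] at h3
  have hfI : γ * f ∈ Ideal.span {f, X 0 * g} := Ideal.mul_mem_left _ _ (Ideal.subset_span (by simp))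
  split_ifs at h3 with hei
  · set β' := homogeneousComponent (i - e) β with hβ'
    -- Since `x * g` lies in the ideal, only the residue of the coefficient of `g` modulo `x`
    -- matters, and that is a scalar times a power of `y`.
    have h5 := IsHomogeneous.sub_mem_span_linearForm (p := ![1, 0]) (q := ![0, 1])
      (by rw [linearForm_zero_one, eval_perp_one_zero_X_one])
      (homogeneousComponent_isHomogeneous (i - e) β)
    rw [linearForm_one_zero, linearForm_zero_one, Ideal.mem_span_singleton] at h5
    obtain ⟨δ, h5⟩ := h5
    have h6 : h - C (eval (perp ![1, 0]) β') * X 1 ^ (i - e) * g ∈ Ideal.span {f, X 0 * g} :=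
      Ideal.mem_span_pair.2 ⟨γ, δ, by linear_combination (-1 : MvPolynomial (Fin 2) K) * h3 - g * h5⟩
    by_cases hc : eval (perp ![1, 0]) β' = 0
    · left
      rwa [hc, C_0, zero_mul, zero_mul, sub_zero] at h6
    · exact Or.inr ⟨hei, _, hc, h6⟩
  · left
    rw [sub_eq_zero] at h3
    rwa [h3]

theorem exists_notMem_of_hilbertFunction_ne_zero {I : Ideal (MvPolynomial (Fin 2) K)} {n : ℕ}
    (h : hilbertFunction I n ≠ 0) :
    ∃ f : MvPolynomial (Fin 2) K, f.IsHomogeneous n ∧ f ∉ I := by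
  by_contra! hall
  apply h
  rw [hilbertFunction, Submodule.finrank_eq_zero, eq_bot_iff]
  rintro _ ⟨f, hf, rfl⟩
  exact Ideal.Quotient.eq_zero_iff_mem.2 (hall f hf)

/-- The socle of a graded complete intersection is concentrated in the top degree. -/
theorem X_mul_notMem_or {I : Ideal (MvPolynomial (Fin 2) K)} (hI : IsGradedCI I) {j : ℕ}
    (hj : hilbertFunction I j ≠ 0) (hj' : hilbertFunction I (j + 1) = 0) {i : ℕ} (hij : i < j)
    {h : MvPolynomial (Fin 2) K} (hh : h.IsHomogeneous i) (hhI : h ∉ I) :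
    X 0 * h ∉ I ∨ X 1 * h ∉ I := by
  obtain ⟨f₀, g₀, a₀, b₀, hf₀, hg₀, -, hI₀⟩ := hI
  obtain ⟨f, g, a, e, hf, hg, hf0, rfl⟩ := exists_span_eq_span_pair_X_mul hf₀ hg₀ hI₀ hj'
  by_contra! hmem
  obtain ⟨w, hw, hwI⟩ := exists_notMem_of_hilbertFunction_ne_zero hj
  obtain ⟨hei, c, hc, h1⟩ := (exists_sub_mem_of_X_mul_mem hf hg hf0 hh hmem.1).resolve_left hhI
  obtain ⟨-, c', -, h2⟩ := (exists_sub_mem_of_X_mul_mem hf hg hf0 hw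
    (mem_of_hilbertFunction_eq_zero hj' (by
      have := (isHomogeneous_X K (0 : Fin 2)).mul hw
      rwa [add_comm] at this))).resolve_left hwI
  apply hwI
  -- A class in degree `i < j` killed by both variables puts `y^(i+1-e) * g` in `I`, and hence every
  -- form of degree `j`, being a multiple of `y^(j-e) * g` modulo `I`.
  have h3 : C c * X 1 ^ (i + 1 - e) * g ∈ Ideal.span {f, X 0 * g} := by
    have := Ideal.sub_mem _ hmem.2 (Ideal.mul_mem_left _ (X 1) h1)
    convert this using 1
    rw [Nat.succ_sub hei, pow_succ]
    ring
  have h4 : C c' * X 1 ^ (j - e) * g ∈ Ideal.span {f, X 0 * g} := by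
    have := Ideal.mul_mem_left _ (C (c' * c⁻¹) * X 1 ^ (j - (i + 1))) h3
    convert this using 1
    have hcc : (C (c' * c⁻¹) * C c : MvPolynomial (Fin 2) K) = C c' := by
      rw [← C_mul, inv_mul_cancel_right₀ hc]
    rw [show j - e = (j - (i + 1)) + (i + 1 - e) by omega, pow_add, ← hcc]
    ring
  simpa using Ideal.add_mem _ h2 h4

theorem exists_mul_notMem {I : Ideal (MvPolynomial (Fin 2) K)} (hI : IsGradedCI I) {j : ℕ}
    (hj : hilbertFunction I j ≠ 0) (hj' : hilbertFunction I (j + 1) = 0) {i m : ℕ}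
    (him : i + m = j) {h : MvPolynomial (Fin 2) K} (hh : h.IsHomogeneous i) (hhI : h ∉ I) :
    ∃ w : MvPolynomial (Fin 2) K, w.IsHomogeneous m ∧ h * w ∉ I := by
  induction m generalizing i h with
  | zero => exact ⟨1, isHomogeneous_one _ _, by rwa [mul_one]⟩
  | succ m ih =>
    have key : ∀ v : Fin 2, X v * h ∉ I →
        ∃ w : MvPolynomial (Fin 2) K, w.IsHomogeneous (m + 1) ∧ h * w ∉ I := by
      intro v hv
      obtain ⟨w, hw, hwI⟩ := ih (i := 1 + i) (by omega) ((isHomogeneous_X K v).mul hh) hv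
      refine ⟨X v * w, ?_, ?_⟩
      · rw [add_comm]
        exact (isHomogeneous_X K v).mul hw
      · rwa [show h * (X v * w) = X v * h * w by ring]
    rcases X_mul_notMem_or hI hj hj' (by omega) hh hhI with h1 | h1
    · exact key 0 h1
    · exact key 1 h1

/-- Every functional on forms of degree `j` is given by differentiating a form of degree `j`. -/
theorem exists_dual_form [CharZero K] {j : ℕ} (θ : homogeneousSubmodule (Fin 2) K j →ₗ[K] K) :
    ∃ F : MvPolynomial (Fin 2) K, F.IsHomogeneous j ∧
      ∀ f : homogeneousSubmodule (Fin 2) K j, coeff 0 (diffOp (f : MvPolynomial (Fin 2) K) F) = θ f := by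
  let L : homogeneousSubmodule (Fin 2) K j →ₗ[K]
      Module.Dual K (homogeneousSubmodule (Fin 2) K j) :=
    LinearMap.mk₂ K (fun F f => coeff 0 (diffOp (f : MvPolynomial (Fin 2) K)
        (F : MvPolynomial (Fin 2) K)))
      (by intros; simp) (by intros; simp) (by intros; simp) (by intros; simp)
  have hinj : Function.Injective L := by
    rw [← LinearMap.ker_eq_bot, LinearMap.ker_eq_bot']
    intro F h
    exact Subtype.ext (eq_zero_of_forall_coeff_diffOp F.2 fun f hf =>
      congrArg (fun φ => φ ⟨f, hf⟩) h)
  obtain ⟨F, hF⟩ := (LinearMap.injective_iff_surjective_of_finrank_eq_finrank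
    (Subspace.dual_finrank_eq).symm).1 hinj θ
  exact ⟨F, F.2, fun f => congrArg (fun φ => φ f) hF⟩

/-- Macaulay duality: a graded complete intersection whose top degree is one-dimensional is the
annihilator of a form. -/
theorem exists_annIdeal_eq [CharZero K] {I : Ideal (MvPolynomial (Fin 2) K)} (hI : IsGradedCI I)
    {j : ℕ} (hj : hilbertFunction I j = 1) (hj' : ∀ i, j < i → hilbertFunction I i = 0) :
    ∃ F : MvPolynomial (Fin 2) K, F.IsHomogeneous j ∧ annIdeal F = I := by
  have hcomp : ∀ n, ∀ f ∈ I, homogeneousComponent n f ∈ I := by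
    obtain ⟨f, g, a, b, hf, hg, -, rfl⟩ := hI
    exact fun n h => homogeneousComponent_mem_span_pair hf hg n h
  let q : homogeneousSubmodule (Fin 2) K j →ₗ[K] gradedPiece I j :=
    ((Ideal.Quotient.mkₐ K I).toLinearMap ∘ₗ (homogeneousSubmodule (Fin 2) K j).subtype).codRestrict
      _ fun f => ⟨f, f.2, rfl⟩
  obtain ⟨ε⟩ : Nonempty (gradedPiece I j ≃ₗ[K] K) :=
    ⟨LinearEquiv.ofFinrankEq _ _ (by rw [Module.finrank_self]; exact hj)⟩
  -- `F` represents the projection onto the one-dimensional top piece. Thus `Ann F` and `I` agree in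
  -- degree `j`; lower degrees follow because a form outside `I` has a multiple of degree `j`
  -- outside `I`.
  obtain ⟨F, hF, hθ⟩ := exists_dual_form (ε.toLinearMap ∘ₗ q)
  have hθ' : ∀ f : MvPolynomial (Fin 2) K, f.IsHomogeneous j →
      (coeff 0 (diffOp f F) = 0 ↔ f ∈ I) := by
    intro f hf
    have h1 := hθ ⟨f, hf⟩
    change coeff 0 (diffOp f F) = ε (q ⟨f, hf⟩) at h1
    rw [h1, LinearEquiv.map_eq_zero_iff, ← Ideal.Quotient.eq_zero_iff_mem]
    exact Subtype.ext_iff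
  have key : ∀ i, ∀ h : MvPolynomial (Fin 2) K, h.IsHomogeneous i → (h ∈ annIdeal F ↔ h ∈ I) := by
    intro i h hh
    rcases lt_or_ge j i with hij | hij
    · exact iff_of_true (diffOp_eq_zero_of_lt hh hF hij)
        (mem_of_hilbertFunction_eq_zero (hj' i hij) hh)
    · obtain ⟨m, rfl⟩ := Nat.exists_eq_add_of_le hij
      rw [mem_annIdeal_iff hF hh]
      constructor
      · intro hall
        by_contra hhI
        obtain ⟨w, hw, hwI⟩ := exists_mul_notMem hI (by rw [hj]; exact one_ne_zero)
          (hj' _ (Nat.lt_succ_self _)) rfl hh hhI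
        exact hwI ((hθ' _ (hh.mul hw)).1 (hall w hw))
      · intro hhI g hg
        exact (hθ' _ (hh.mul hg)).2 (I.mul_mem_right _ hhI)
  refine ⟨F, hF, ?_⟩
  ext f
  constructor
  · intro h
    rw [← sum_homogeneousComponent f]
    exact I.sum_mem fun i _ => (key i _ (homogeneousComponent_isHomogeneous i f)).1
      (homogeneousComponent_mem_annIdeal hF i f h)
  · intro h
    rw [← sum_homogeneousComponent f]
    exact Ideal.sum_mem _ fun i _ => (key i _ (homogeneousComponent_isHomogeneous i f)).2
      (hcomp i f h)

theorem exists_isCIDualGenerator [CharZero K] {d k : ℕ} (hd : 2 ≤ d)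
    {I : Ideal (MvPolynomial (Fin 2) K)} (hI : IsGradedCI I)
    (hT : ∀ i, hilbertFunction I i = seqT d k i) :
    ∃ F : MvPolynomial (Fin 2) K, IsCIDualGenerator d k F ∧ annIdeal F = I := by
  obtain ⟨F, hF, rfl⟩ := exists_annIdeal_eq hI (j := 2 * d + k - 3)
    (by rw [hT, seqT]; omega) (fun i hi => by rw [hT, seqT_eq_zero hi])
  exact ⟨F, ⟨hF, hI, hT⟩, rfl⟩

end Macaulay

/-! ### Complete intersections with prescribed block ends. -/

section Construction

variable {K : Type*} [Field K]

theorem isGradedCI_span_pair {f g : MvPolynomial (Fin 2) K} {a b : ℕ} (hf : f.IsHomogeneous a)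
    (hg : g.IsHomogeneous b) (hf0 : f ≠ 0) (hfg : IsRelPrime f g)
    (htop : Ideal.span {f, g} ≠ ⊤) : IsGradedCI (Ideal.span {f, g}) := by
  refine ⟨f, g, a, b, hf, hg, ?_, rfl⟩
  rw [RingTheory.Sequence.isRegular_iff, RingTheory.Sequence.isWeaklyRegular_cons_iff,
    RingTheory.Sequence.isWeaklyRegular_singleton_iff]
  refine ⟨⟨?_, ?_⟩, ?_⟩
  · exact fun x y h => mul_left_cancel₀ hf0 h
  · refine (isSMulRegular_quotient_iff_mem_of_smul_mem _ _).2 fun z hz => ?_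
    rw [Submodule.mem_smul_pointwise_iff_exists] at hz ⊢
    obtain ⟨w, -, hw⟩ := hz
    obtain ⟨v, hv⟩ := hfg.dvd_of_dvd_mul_left ⟨w, hw.symm⟩
    exact ⟨v, trivial, hv.symm⟩
  · rw [smul_eq_mul, Ideal.mul_top]
    intro h
    apply htop
    rw [h]
    congr 1
    ext
    simp

/-- The degree `s` is the last one of a block of strings of equal length. -/
def IsBlockEnd (I : Ideal (MvPolynomial (Fin 2) K)) (s : ℕ) : Prop :=
  ∃ a, ¬ Reduces I ![1, 0] s a ∧ Reduces I ![1, 0] (s + 1) a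

/-- The Hilbert function of a complete intersection of degrees `a` and `b`. -/
def hilbertCI (a b i : ℕ) : ℕ := min (min (i + 1) (min a b)) (a + b - 1 - i)

variable {u v : MvPolynomial (Fin 2) K} {α β : ℕ}

/-- The first `t` columns have height exactly `β`: as `x` does not divide `u`, the factor `x^a`
cancels and leaves `g` congruent to a multiple of `u` modulo `x`. -/
theorem reduces_span_pair_of_lt (hu : u.IsHomogeneous β) (hu0 : eval (perp ![1, 0]) u ≠ 0)
    {a t : ℕ} (hat : a < t) (s : ℕ) :
    Reduces (Ideal.span {u, X 0 ^ t * v}) ![1, 0] s a ↔ β ≤ s := by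
  constructor
  · rintro ⟨g, hg, hg0, hI⟩
    by_contra hlt
    apply hg0
    rw [linearForm_one_zero] at hI
    obtain ⟨A, B, h⟩ := Ideal.mem_span_pair.1 hI
    obtain ⟨t', rfl⟩ := Nat.exists_eq_add_of_lt hat
    obtain ⟨A', rfl⟩ := X_prime.pow_dvd_of_dvd_mul_right a (p := (X 0 : MvPolynomial (Fin 2) K))
      (a := A) (b := u) (by rintro ⟨z, rfl⟩; exact hu0 (by simp [perp]))
      ⟨g - B * X 0 ^ (t' + 1) * v, by linear_combination h⟩
    have h2 : g = A' * u + B * X 0 ^ t' * v * X 0 := by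
      refine mul_left_cancel₀ (pow_ne_zero a (X_ne_zero (0 : Fin 2))) ?_
      linear_combination -h
    have h3 := homogeneousComponent_eq_self hg
    rw [h2, map_add, homogeneousComponent_mul_of_isHomogeneous hu, if_neg hlt, zero_add, ← h2,
      homogeneousComponent_mul_of_isHomogeneous (isHomogeneous_X K (0 : Fin 2))] at h3
    rw [← h3]
    split_ifs
    · simp [perp]
    · simp
  · intro h
    refine ⟨X 1 ^ (s - β) * u, ?_, ?_, ?_⟩
    · have := (isHomogeneous_X_pow (R := K) (1 : Fin 2) (s - β)).mul hu
      rwa [Nat.sub_add_cancel h] at this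
    · rw [map_mul, map_pow, eval_perp_one_zero_X_one, one_pow, one_mul]
      exact hu0
    · exact Ideal.mul_mem_left _ _ (Ideal.mul_mem_left _ _ (Ideal.subset_span (by simp)))

/-- Beyond the first `t` columns the diagram is that of `(u, v)`, since `x^t` can be cancelled from
any relation. -/
theorem reduces_span_pair_add (hu0 : eval (perp ![1, 0]) u ≠ 0) (t a s : ℕ) :
    Reduces (Ideal.span {u, X 0 ^ t * v}) ![1, 0] s (t + a) ↔
      Reduces (Ideal.span {u, v}) ![1, 0] s a := by
  refine exists_congr fun g => and_congr_right fun _ => and_congr_right fun _ => ?_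
  rw [linearForm_one_zero]
  constructor
  · intro hI
    obtain ⟨A, B, h⟩ := Ideal.mem_span_pair.1 hI
    obtain ⟨A', rfl⟩ := X_prime.pow_dvd_of_dvd_mul_right t (p := (X 0 : MvPolynomial (Fin 2) K))
      (a := A) (b := u) (by rintro ⟨z, rfl⟩; exact hu0 (by simp [perp]))
      ⟨X 0 ^ a * g - B * v, by linear_combination h⟩
    refine Ideal.mem_span_pair.2 ⟨A', B, ?_⟩
    refine mul_left_cancel₀ (pow_ne_zero t (X_ne_zero (0 : Fin 2))) ?_
    linear_combination h
  · intro hI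
    obtain ⟨A, B, h⟩ := Ideal.mem_span_pair.1 hI
    exact Ideal.mem_span_pair.2 ⟨X 0 ^ t * A, B, by linear_combination X 0 ^ t * h⟩

theorem isBlockEnd_span_pair (hu : u.IsHomogeneous β) (hu0 : eval (perp ![1, 0]) u ≠ 0)
    {t : ℕ} (ht : 1 ≤ t) (s : ℕ) :
    IsBlockEnd (Ideal.span {u, X 0 ^ t * v}) s ↔ s + 1 = β ∨ IsBlockEnd (Ideal.span {u, v}) s := by
  constructor
  · rintro ⟨a, h1, h2⟩
    rcases lt_or_ge a t with hat | hat
    · rw [reduces_span_pair_of_lt hu hu0 hat] at h1 h2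
      left; omega
    · obtain ⟨a, rfl⟩ := Nat.exists_eq_add_of_le hat
      rw [reduces_span_pair_add hu0] at h1 h2
      exact Or.inr ⟨a, h1, h2⟩
  · rintro (h | ⟨a, h1, h2⟩)
    · refine ⟨0, ?_, ?_⟩
      · rw [reduces_span_pair_of_lt hu hu0 ht]; omega
      · rw [reduces_span_pair_of_lt hu hu0 ht]; omega
    · exact ⟨t + a, by rwa [reduces_span_pair_add hu0], by rwa [reduces_span_pair_add hu0]⟩

/-- Gluing on one column of height `β` shifts the old diagonals by one and adds one box to each
diagonal of index below `β`. -/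
theorem hilbertFunction_span_pair (hu : u.IsHomogeneous β) (hu0 : eval (perp ![1, 0]) u ≠ 0)
    (hβ : 1 ≤ β) (h : ∀ i, hilbertFunction (Ideal.span {u, v}) i = hilbertCI β α i) (t i : ℕ) :
    hilbertFunction (Ideal.span {u, X 0 ^ t * v}) i = hilbertCI β (t + α) i := by
  classical
  induction t generalizing i with
  | zero => rw [pow_zero, one_mul, zero_add, h]
  | succ t ih =>
    have hpow : X 0 ^ (t + 1) * v = X 0 ^ 1 * (X 0 ^ t * v) := by ring
    rw [hpow, hilbertFunction_eq_card _ one_zero_ne_zero]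
    rcases i with _ | i
    · have : ¬ Reduces (Ideal.span {u, X 0 ^ 1 * (X 0 ^ t * v)}) ![1, 0] 0 0 := by
        rw [reduces_span_pair_of_lt hu hu0 Nat.one_pos]; omega
      rw [zero_add, Finset.range_one, Finset.filter_singleton, if_pos this, Finset.card_singleton,
        hilbertCI]
      omega
    · have hi := ih i
      rw [hilbertFunction_eq_card _ one_zero_ne_zero] at hi
      have hfilter : (Finset.range (i + 1)).filter (fun s =>
          ¬ Reduces (Ideal.span {u, X 0 ^ 1 * (X 0 ^ t * v)}) ![1, 0] s (i + 1 - s)) =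
          (Finset.range (i + 1)).filter fun s =>
            ¬ Reduces (Ideal.span {u, X 0 ^ t * v}) ![1, 0] s (i - s) := by
        refine Finset.filter_congr fun s hs => ?_
        rw [Finset.mem_range] at hs
        rw [show i + 1 - s = 1 + (i - s) by omega, reduces_span_pair_add hu0]
      rw [Finset.range_add_one, Finset.filter_insert, hfilter, Nat.sub_self,
        reduces_span_pair_of_lt hu hu0 Nat.one_pos]
      split_ifs with hs
      · rw [hi, hilbertCI, hilbertCI]
        omega
      · rw [Finset.card_insert_of_notMem (by simp), hi, hilbertCI, hilbertCI]
        omega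

/-- A pair of coprime forms of degrees `β > α`, the first one monic in `y`, generating an ideal
whose blocks of strings end exactly in the degrees of `Z`. -/
structure IsBlockPair (α β : ℕ) (Z : Finset ℕ) (u v : MvPolynomial (Fin 2) K) : Prop where
  isHomogeneous_left : u.IsHomogeneous β
  isHomogeneous_right : v.IsHomogeneous α
  eval_ne_zero : eval (perp ![1, 0]) u ≠ 0
  isRelPrime : IsRelPrime u v
  hilbertFunction_eq : ∀ i, hilbertFunction (Ideal.span {u, v}) i = hilbertCI β α i
  isBlockEnd_iff : ∀ i, IsBlockEnd (Ideal.span {u, v}) i ↔ i ∈ Z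

theorem isBlockPair_X_pow_one (β : ℕ) :
    IsBlockPair 0 β ∅ (X 1 ^ β : MvPolynomial (Fin 2) K) 1 := by
  have htop : Ideal.span {(X 1 ^ β : MvPolynomial (Fin 2) K), 1} = ⊤ :=
    Ideal.eq_top_of_isUnit_mem _ (Ideal.subset_span (by simp)) isUnit_one
  have hred : ∀ s a, Reduces (⊤ : Ideal (MvPolynomial (Fin 2) K)) ![1, 0] s a := fun s a =>
    ⟨X 1 ^ s, isHomogeneous_X_pow _ _, by rw [map_pow, eval_perp_one_zero_X_one]; simp, trivial⟩
  refine ⟨isHomogeneous_X_pow _ _, isHomogeneous_one _ _,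
    by rw [map_pow, eval_perp_one_zero_X_one]; simp, isRelPrime_one_right, fun i => ?_, fun i => ?_⟩
  · classical
    rw [htop, hilbertFunction_eq_card _ one_zero_ne_zero, hilbertCI]
    simp [hred]
  · rw [htop]
    simp [IsBlockEnd, hred]

theorem isRelPrime_X_pow_right (hu0 : eval (perp ![1, 0]) u ≠ 0) (t : ℕ) :
    IsRelPrime u (X 0 ^ t) := by
  refine IsRelPrime.pow_right ?_
  refine (X_prime.irreducible.isRelPrime_iff_not_dvd.2 ?_).symm
  rintro ⟨z, rfl⟩
  exact hu0 (by simp [perp])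

/-- The ideal is that of `(u, x^(γ-α) v)`, whose diagram gains a rectangle of height `β` and hence a
block end at `β - 1`. Adding `y^(γ-β) u` keeps the new first generator nonzero modulo `x`, so the
step can be repeated. -/
theorem IsBlockPair.next {Z : Finset ℕ} (h : IsBlockPair α β Z u v) {γ : ℕ} (hαβ : α < β)
    (hβγ : β < γ) :
    IsBlockPair β γ (insert (β - 1) Z) (X 0 ^ (γ - α) * v + X 1 ^ (γ - β) * u) u := by
  have hspan : Ideal.span {X 0 ^ (γ - α) * v + X 1 ^ (γ - β) * u, u} =
      Ideal.span {u, X 0 ^ (γ - α) * v} := by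
    rw [Ideal.span_pair_comm, ← span_pair_sub_mul u (X 0 ^ (γ - α) * v) (-X 1 ^ (γ - β))]
    congr 3
    ring
  refine ⟨?_, h.isHomogeneous_left, ?_, ?_, fun i => ?_, fun i => ?_⟩
  · refine IsHomogeneous.add ?_ ?_
    · have := (isHomogeneous_X_pow (R := K) (0 : Fin 2) (γ - α)).mul h.isHomogeneous_right
      rwa [Nat.sub_add_cancel (by omega)] at this
    · have := (isHomogeneous_X_pow (R := K) (1 : Fin 2) (γ - β)).mul h.isHomogeneous_left
      rwa [Nat.sub_add_cancel (by omega)] at this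
  · have h0 : eval (perp ![1, 0]) (X 0 : MvPolynomial (Fin 2) K) = 0 := by simp [perp]
    rw [map_add, map_mul, map_mul, map_pow, map_pow, eval_perp_one_zero_X_one, h0,
      zero_pow (by omega), zero_mul, zero_add, one_pow, one_mul]
    exact h.eval_ne_zero
  · have h1 := ((isRelPrime_X_pow_right h.eval_ne_zero (γ - α)).mul_right h.isRelPrime).symm
    refine IsRelPrime.of_add_mul_right_left (z := -X 1 ^ (γ - β)) ?_
    rwa [show X 0 ^ (γ - α) * v + X 1 ^ (γ - β) * u + -X 1 ^ (γ - β) * u =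
      X 0 ^ (γ - α) * v by ring]
  · rw [hspan, hilbertFunction_span_pair h.isHomogeneous_left h.eval_ne_zero (by omega)
      h.hilbertFunction_eq, Nat.sub_add_cancel (by omega), hilbertCI, hilbertCI]
    omega
  · rw [hspan, isBlockEnd_span_pair h.isHomogeneous_left h.eval_ne_zero (by omega),
      h.isBlockEnd_iff, Finset.mem_insert]
    refine or_congr_left ?_
    omega

theorem exists_isBlockPair (Z : Finset ℕ) : ∀ β, (∀ i ∈ Z, i + 1 < β) → 1 ≤ β →
    ∃ α < β, (∀ m, (∀ i ∈ Z, i < m) → α ≤ m) ∧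
      ∃ u v : MvPolynomial (Fin 2) K, IsBlockPair α β Z u v := by
  induction Z using Finset.induction_on_max with
  | empty => exact fun β _ hβ => ⟨0, hβ, by simp, _, _, isBlockPair_X_pow_one β⟩
  | insert b Z hb ih =>
    intro β hβ _
    -- With `b` the largest prescribed end, a first generator of degree `b + 1` makes the next step
    -- create exactly that end.
    obtain ⟨α, hα, -, u, v, huv⟩ :=
      ih (b + 1) (fun i hi => by have := hb i hi; omega) (by omega)
    have hbβ := hβ b (Finset.mem_insert_self _ _)
    have := huv.next hα hbβ
    rw [Nat.add_sub_cancel] at this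
    exact ⟨b + 1, hbβ, fun m hm => hm b (Finset.mem_insert_self _ _), _, _, this⟩

/-- Complete intersections of Hilbert function `T(d,k)` with any prescribed set of ends of blocks
of strings among the active degrees. -/
theorem exists_isGradedCI_isBlockEnd_iff {d k : ℕ} (hd : 2 ≤ d) (hk : 1 ≤ k) (E : Finset ℕ) :
    ∃ I : Ideal (MvPolynomial (Fin 2) K), IsGradedCI I ∧
      (∀ i, hilbertFunction I i = seqT d k i) ∧
      ∀ i < numActive d k, IsBlockEnd I i ↔ i ∈ E := by
  have key : ∀ (β : ℕ) (Z : Finset ℕ), (∀ i ∈ Z, i < d - 1) → (β = d ∨ β = d + k - 1) →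
      (∀ i < numActive d k, (i + 1 = β ∨ i ∈ Z) ↔ i ∈ E) →
      ∃ I : Ideal (MvPolynomial (Fin 2) K), IsGradedCI I ∧
      (∀ i, hilbertFunction I i = seqT d k i) ∧
      ∀ i < numActive d k, IsBlockEnd I i ↔ i ∈ E := by
    intro β Z hZ hβ hE
    obtain ⟨α, hα, hαm, u, v, huv⟩ := exists_isBlockPair (K := K) Z β
      (fun i hi => by have := hZ i hi; omega) (by omega)
    have hαd := hαm (d - 1) hZ
    -- This makes the generator degrees `d` and `d + k - 1`, in one order or the other. The last
    -- rectangle has height `β`: taking `β = d` creates the end `d - 1`, while `β = d + k - 1`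
    -- creates only the inactive end `d + k - 2`.
    set t := 2 * d + k - 1 - β - α with ht
    have hhilb : ∀ i, hilbertFunction (Ideal.span {u, X 0 ^ t * v}) i = seqT d k i := by
      intro i
      rw [hilbertFunction_span_pair huv.isHomogeneous_left huv.eval_ne_zero (by omega)
        huv.hilbertFunction_eq, hilbertCI, seqT]
      omega
    refine ⟨Ideal.span {u, X 0 ^ t * v}, ?_, hhilb, fun i hi => ?_⟩
    · refine isGradedCI_span_pair huv.isHomogeneous_left
        ((isHomogeneous_X_pow (R := K) (0 : Fin 2) t).mul huv.isHomogeneous_right) ?_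
        ((isRelPrime_X_pow_right huv.eval_ne_zero t).mul_right huv.isRelPrime) ?_
      · rintro rfl
        exact huv.eval_ne_zero (map_zero _)
      · intro htop
        obtain ⟨f, -, hf⟩ := exists_notMem_of_hilbertFunction_ne_zero
          (I := Ideal.span {u, X 0 ^ t * v}) (n := 0) (by rw [hhilb, seqT]; omega)
        rw [htop] at hf
        exact hf trivial
    · rw [isBlockEnd_span_pair huv.isHomogeneous_left huv.eval_ne_zero (by omega),
        huv.isBlockEnd_iff, hE i hi]
  by_cases h : 2 ≤ k ∧ d - 1 ∈ E
  · refine key d (E.filter (· < d - 1)) (fun i hi => (Finset.mem_filter.1 hi).2) (Or.inl rfl)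
      fun i hi => ?_
    rw [numActive, if_pos h.1] at hi
    rw [Finset.mem_filter]
    constructor
    · rintro (h1 | h1)
      · rw [show i = d - 1 by omega]
        exact h.2
      · exact h1.1
    · intro h1
      by_cases h2 : i + 1 = d
      · exact Or.inl h2
      · exact Or.inr ⟨h1, by omega⟩
  · refine key (d + k - 1) (E.filter (· < d - 1)) (fun i hi => (Finset.mem_filter.1 hi).2)
      (Or.inr rfl) fun i hi => ?_
    rw [Finset.mem_filter]
    rw [numActive] at hi
    constructor
    · rintro (h1 | h1)
      · split_ifs at hi <;> omega
      · exact h1.1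
    · intro h1
      refine Or.inr ⟨h1, ?_⟩
      split_ifs at hi with hk2
      · have : i ≠ d - 1 := by
          rintro rfl
          exact h ⟨hk2, h1⟩
        omega
      · exact hi

end Construction

/-! ### The bijection, the count and the explicit partitions. -/

section Main

variable {K : Type*} [Field K]

/-- The set of active degrees that are not the last one of a block of equal rows. -/
def nonDropSet (d k : ℕ) (P : YoungDiagram) : Set (Fin (numActive d k)) :=
  {i | ¬ P.rowLen (i + 1) < P.rowLen i}

theorem two_mul_le_of_lt_numActive {d k i : ℕ} (hd : 2 ≤ d) (hk : 1 ≤ k)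
    (hi : i < numActive d k) : 2 * i ≤ 2 * d + k - 3 ∧ i < d := by
  rw [numActive] at hi
  split_ifs at hi <;> omega

variable {d k : ℕ} {F : MvPolynomial (Fin 2) K} {p : Fin 2 → K}

theorem IsCIDualGenerator.exists_youngDiagram (hF : IsCIDualGenerator d k F) (hp : p ≠ 0) :
    ∃ P : YoungDiagram, ∀ s a, (s, a) ∈ P ↔ ¬ Reduces (annIdeal F) p s a :=
  CIJordan.exists_youngDiagram hp (J := 2 * d + k - 3) fun i hi => by
    rw [hF.hilbertFunction_eq, seqT_eq_zero hi]

theorem IsCIDualGenerator.isJordanType_iff (hF : IsCIDualGenerator d k F) (hp : p ≠ 0)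
    {P : YoungDiagram} :
    IsJordanType (mulLinear (annIdeal F) p) P ↔
      ∀ s a, (s, a) ∈ P ↔ ¬ Reduces (annIdeal F) p s a := by
  have hI := homogeneousComponent_mem_annIdeal hF.isHomogeneous
  refine ⟨fun h => ?_, isJordanType_of_mem_iff hp hI⟩
  obtain ⟨P', hP'⟩ := hF.exists_youngDiagram hp
  rwa [h.unique (isJordanType_of_mem_iff hp hI hP')]

theorem IsCIDualGenerator.exists_isJordanType (hF : IsCIDualGenerator d k F) (hp : p ≠ 0) :
    ∃ P : YoungDiagram, IsJordanType (mulLinear (annIdeal F) p) P := by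
  obtain ⟨P, hP⟩ := hF.exists_youngDiagram hp
  exact ⟨P, (hF.isJordanType_iff hp).2 hP⟩

variable [CharZero K]

theorem IsJordanType.isGorensteinDiagram {P : YoungDiagram}
    (h : IsJordanType (mulLinear (annIdeal F) p) P) (hF : IsCIDualGenerator d k F) (hp : p ≠ 0) :
    IsGorensteinDiagram d k P :=
  hF.isGorensteinDiagram hp ((hF.isJordanType_iff hp).1 h)

/-- The vanishing active Hessians are read off from the Jordan type. -/
theorem IsJordanType.vanishingSet_eq {P : YoungDiagram} (hd : 2 ≤ d) (hk : 1 ≤ k)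
    (h : IsJordanType (mulLinear (annIdeal F) p) P) (hF : IsCIDualGenerator d k F) (hp : p ≠ 0) :
    vanishingSet d k F p = nonDropSet d k P := by
  ext i
  obtain ⟨h1, h2⟩ := two_mul_le_of_lt_numActive hd hk i.2
  change hessianAt F i p = 0 ↔ ¬ P.rowLen (i + 1) < P.rowLen i
  rw [← (h.isGorensteinDiagram hF hp).forall_mem_iff_drop h1,
    ← hessianAt_ne_zero_iff_forall_mem hk hF hp ((hF.isJordanType_iff hp).1 h) h1 h2, not_not]

theorem IsGorensteinDiagram.eq_of_nonDropSet_eq {P P' : YoungDiagram} (hd : 2 ≤ d) (hk : 1 ≤ k)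
    (h : IsGorensteinDiagram d k P) (h' : IsGorensteinDiagram d k P')
    (hPP' : nonDropSet d k P = nonDropSet d k P') : P = P' :=
  h.ext_of_drop_iff h' hk hd fun i hi =>
    not_iff_not.1 (Set.ext_iff.1 hPP' ⟨i, hi⟩)

theorem IsGorensteinDiagram.diagonalLength_eq {P : YoungDiagram}
    (h : IsGorensteinDiagram d k P) (i : ℕ) : diagonalLength P i = seqT d k i := by
  rw [← h.card_eq i, diagonalLength]
  refine Finset.card_bij' (fun c _ => c.1) (fun s _ => (s, i - s)) ?_ ?_ ?_ ?_
  · rintro ⟨s, a⟩ hc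
    simp only [Finset.mem_filter, YoungDiagram.mem_cells, Finset.mem_range] at hc ⊢
    rw [show i - s = a by omega]
    exact ⟨by omega, hc.1⟩
  · intro s hs
    simp only [Finset.mem_filter, YoungDiagram.mem_cells, Finset.mem_range] at hs ⊢
    exact ⟨hs.2, by omega⟩
  · rintro ⟨s, a⟩ hc
    simp only [Finset.mem_filter] at hc
    simp only [Prod.mk.injEq, true_and]
    omega
  · intros; rfl

theorem IsCIDualGenerator.isCIJT {P : YoungDiagram} (hF : IsCIDualGenerator d k F) (hp : p ≠ 0)
    (h : IsJordanType (mulLinear (annIdeal F) p) P) : IsCIJT K d k P :=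
  ⟨(h.isGorensteinDiagram hF hp).diagonalLength_eq, _, hF.isGradedCI, hF.hilbertFunction_eq,
    p, hp, h⟩

theorem IsCIJT.exists_isCIDualGenerator {P : YoungDiagram} (hd : 2 ≤ d) (h : IsCIJT K d k P) :
    ∃ (F : MvPolynomial (Fin 2) K) (p : Fin 2 → K), IsCIDualGenerator d k F ∧ p ≠ 0 ∧
      IsJordanType (mulLinear (annIdeal F) p) P := by
  obtain ⟨-, I, hI, hT, p, hp, hP⟩ := h
  obtain ⟨F, hF, rfl⟩ := CIJordan.exists_isCIDualGenerator hd hI hT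
  exact ⟨F, p, hF, hp, hP⟩

/-- Every set of active Hessians is the set of vanishing ones for some algebra and linear form. -/
theorem exists_vanishingSet_eq (K : Type*) [Field K] [CharZero K] (hd : 2 ≤ d) (hk : 1 ≤ k)
    (S : Set (Fin (numActive d k))) :
    ∃ (F : MvPolynomial (Fin 2) K) (p : Fin 2 → K), IsCIDualGenerator d k F ∧ p ≠ 0 ∧
      vanishingSet d k F p = S := by
  classical
  -- Vanishing Hessians are the non-drops, so the prescribed block ends are the complement of `S`.
  obtain ⟨I, hI, hT, hE⟩ := exists_isGradedCI_isBlockEnd_iff (K := K) hd hk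
    ((Finset.univ.filter fun i => i ∉ S).map Fin.valEmbedding)
  obtain ⟨F, hF, rfl⟩ := CIJordan.exists_isCIDualGenerator hd hI hT
  obtain ⟨P, hP⟩ := hF.exists_isJordanType one_zero_ne_zero
  refine ⟨F, ![1, 0], hF, one_zero_ne_zero, ?_⟩
  rw [hP.vanishingSet_eq hd hk hF one_zero_ne_zero]
  have hmem := (hF.isJordanType_iff one_zero_ne_zero).1 hP
  ext i
  have h1 : P.rowLen (i + 1) < P.rowLen i ↔ IsBlockEnd (annIdeal F) i := by
    constructor
    · intro h
      refine ⟨P.rowLen (i + 1), (hmem _ _).1 (YoungDiagram.mem_iff_lt_rowLen.2 h), ?_⟩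
      by_contra h2
      exact lt_irrefl _ (YoungDiagram.mem_iff_lt_rowLen.1 ((hmem _ _).2 h2))
    · rintro ⟨a, h2, h3⟩
      have h4 := YoungDiagram.mem_iff_lt_rowLen.1 ((hmem _ _).2 h2)
      by_contra h5
      exact (hmem _ _).1 (YoungDiagram.mem_iff_lt_rowLen.2 (by omega)) h3
  change ¬ _ ↔ _
  rw [h1, hE i i.2]
  simp [← Fin.ext_iff]

theorem rowLens_eq_explicitParts_of_vanishingSet_eq {P : YoungDiagram} (hd : 2 ≤ d) (hk : 1 ≤ k)
    (h : IsJordanType (mulLinear (annIdeal F) p) P) (hF : IsCIDualGenerator d k F) (hp : p ≠ 0)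
    {n : ℕ} (c : Composition n) (hn : n ≤ numActive d k)
    (hc : vanishingSet d k F p = gapSet d k c) : P.rowLens = explicitParts d k c := by
  refine (h.isGorensteinDiagram hF hp).rowLens_eq_explicitParts hk hd c hn fun m hm => ?_
  rw [h.vanishingSet_eq hd hk hF hp] at hc
  have h1 := Set.ext_iff.1 hc ⟨m, hm⟩
  change (¬ _ ↔ ∀ i : Fin c.length, m ≠ c.sizeUpTo (i + 1) - 1) at h1
  rw [← not_iff_not, h1]
  push Not
  rfl

theorem rowLens_injective : Function.Injective YoungDiagram.rowLens := fun P P' h => by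
  rw [← YoungDiagram.ofRowLens_to_rowLens_eq_self (μ := P),
    ← YoungDiagram.ofRowLens_to_rowLens_eq_self (μ := P')]
  simp only [h]

/-- The bijection between partitions and sets of vanishing active Hessians. -/
def vanishingEquiv (K : Type*) [Field K] [CharZero K] (hd : 2 ≤ d) (hk : 1 ≤ k) :
    {P : YoungDiagram // IsCIJT K d k P} ≃ Set (Fin (numActive d k)) :=
  Equiv.ofBijective (fun P => nonDropSet d k P.1) <| by
    constructor
    · rintro ⟨P, hP⟩ ⟨P', hP'⟩ h
      obtain ⟨F, p, hF, hp, hJ⟩ := hP.exists_isCIDualGenerator hd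
      obtain ⟨F', p', hF', hp', hJ'⟩ := hP'.exists_isCIDualGenerator hd
      exact Subtype.ext ((hJ.isGorensteinDiagram hF hp).eq_of_nonDropSet_eq hd hk
        (hJ'.isGorensteinDiagram hF' hp') h)
    · intro S
      obtain ⟨F, p, hF, hp, rfl⟩ := exists_vanishingSet_eq K hd hk S
      obtain ⟨P, hP⟩ := hF.exists_isJordanType hp
      exact ⟨⟨P, hF.isCIJT hp hP⟩, (hP.vanishingSet_eq hd hk hF hp).symm⟩

theorem vanishingEquiv_eq_iff (hd : 2 ≤ d) (hk : 1 ≤ k) (P : {P : YoungDiagram // IsCIJT K d k P})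
    (S : Set (Fin (numActive d k))) :
    vanishingEquiv K hd hk P = S ↔ ∃ (F : MvPolynomial (Fin 2) K) (p : Fin 2 → K),
      IsCIDualGenerator d k F ∧ p ≠ 0 ∧ IsJordanType (mulLinear (annIdeal F) p) P.1 ∧
        vanishingSet d k F p = S := by
  change nonDropSet d k P.1 = S ↔ _
  constructor
  · rintro rfl
    obtain ⟨F, p, hF, hp, hJ⟩ := P.2.exists_isCIDualGenerator hd
    exact ⟨F, p, hF, hp, hJ, hJ.vanishingSet_eq hd hk hF hp⟩
  · rintro ⟨F, p, hF, hp, hJ, rfl⟩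
    exact (hJ.vanishingSet_eq hd hk hF hp).symm

theorem ncard_isCIJT (K : Type*) [Field K] [CharZero K] (hd : 2 ≤ d) (hk : 1 ≤ k) :
    {P : YoungDiagram | IsCIJT K d k P}.ncard = 2 ^ numActive d k := by
  rw [← Nat.card_coe_set_eq]
  refine (Nat.card_congr (vanishingEquiv K hd hk)).trans ?_
  rw [Nat.card_eq_fintype_card, Fintype.card_set, Fintype.card_fin]

end Main

end

end CIJordan

open CIJordan in
theorem theorem3p6 {K : Type*} [Field K] [CharZero K] (d k : ℕ) (hd : 2 ≤ d) (hk : 1 ≤ k) :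
    -- the correspondence between CIJT partitions and subsets of vanishing active Hessians
    (∃ Φ : {P : YoungDiagram // IsCIJT K d k P} ≃ Set (Fin (numActive d k)),
      ∀ (P : {P : YoungDiagram // IsCIJT K d k P}) (S : Set (Fin (numActive d k))),
        Φ P = S ↔ ∃ (F : MvPolynomial (Fin 2) K) (p : Fin 2 → K),
          IsCIDualGenerator d k F ∧ p ≠ 0 ∧ IsJordanType (mulLinear (annIdeal F) p) P.1 ∧
            vanishingSet d k F p = S) ∧
    -- the number of them
    (2 ≤ k → {P : YoungDiagram | IsCIJT K d k P}.ncard = 2 ^ d) ∧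
    (k = 1 → {P : YoungDiagram | IsCIJT K d k P}.ncard = 2 ^ (d - 1)) ∧
    -- the explicit description, for each ordered partition `c` of `n`
    (∀ (n : ℕ) (c : Composition n), n ≤ numActive d k → ∀ P : YoungDiagram,
      -- which partitions occur with the given set of vanishing active Hessians
      ((∃ (F : MvPolynomial (Fin 2) K) (p : Fin 2 → K),
          IsCIDualGenerator d k F ∧ p ≠ 0 ∧ IsJordanType (mulLinear (annIdeal F) p) P ∧
            vanishingSet d k F p = gapSet d k c) ↔ P.rowLens = explicitParts d k c) ∧
      -- and the same for each individual algebra and linear form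
      (P.rowLens = explicitParts d k c →
        ∀ (F : MvPolynomial (Fin 2) K) (p : Fin 2 → K), IsCIDualGenerator d k F → p ≠ 0 →
          (IsJordanType (mulLinear (annIdeal F) p) P ↔
            vanishingSet d k F p = gapSet d k c))) := by
  refine ⟨⟨vanishingEquiv K hd hk, vanishingEquiv_eq_iff hd hk⟩, fun hk2 => ?_, fun hk1 => ?_,
    fun n c hn P => ⟨⟨?_, fun hP => ?_⟩, fun hP F p hF hp => ⟨fun hJ => ?_, fun hS => ?_⟩⟩⟩
  · rw [ncard_isCIJT K hd hk, numActive, if_pos hk2]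
  · rw [ncard_isCIJT K hd hk, numActive, if_neg (by omega)]
  · rintro ⟨F, p, hF, hp, hJ, hS⟩
    exact rowLens_eq_explicitParts_of_vanishingSet_eq hd hk hJ hF hp c hn hS
  · obtain ⟨F, p, hF, hp, hS⟩ := exists_vanishingSet_eq K hd hk (gapSet d k c)
    obtain ⟨P', hP'⟩ := hF.exists_isJordanType hp
    have h := rowLens_eq_explicitParts_of_vanishingSet_eq hd hk hP' hF hp c hn hS
    obtain rfl := rowLens_injective (h.trans hP.symm)
    exact ⟨F, p, hF, hp, hP', hS⟩
  -- A realization of the gap set has the same row lengths and hence the same diagram `P`; since `P`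
  -- determines the vanishing set, the given `F` and `p` have it too.
  · obtain ⟨F', p', hF', hp', hS'⟩ := exists_vanishingSet_eq K hd hk (gapSet d k c)
    obtain ⟨P', hP'⟩ := hF'.exists_isJordanType hp'
    have h := rowLens_eq_explicitParts_of_vanishingSet_eq hd hk hP' hF' hp' c hn hS'
    obtain rfl := rowLens_injective (h.trans hP.symm)
    rw [hJ.vanishingSet_eq hd hk hF hp, ← hP'.vanishingSet_eq hd hk hF' hp', hS']
  · obtain ⟨P', hP'⟩ := hF.exists_isJordanType hp
    have h := rowLens_eq_explicitParts_of_vanishingSet_eq hd hk hP' hF hp c hn hS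
    obtain rfl := rowLens_injective (h.trans hP.symm)
    exact hP'
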